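/- Let $q$ be a prime power, $m$ a prime with $m \mid q-1$, $F$ a field with $q$ elements, $K/F$ a field extension of degree $m$, $\sigma$ a generator of $\mathrm{Gal}(K/F)$, and $s = (q^m-1)/(q-1)$. For $a \in K \setminus F$ let $A = (K/F,\sigma,a) = K[t;\sigma]/K[t;\sigma](t^m-a)$ be the nonassociative cyclic algebra: its elements are the twisted polynomials of degree less than $m$ in $K[t;\sigma]$ (where $tc = \sigma(c)t$ for $c\in K$), and the product $g\circ h$ is the remainder of $gh$ after right division by $t^m-a$. Let $\mathrm{Aut}_F(A)$ be the group of $F$-algebra automorphisms of $A$. An automorphism $G$ is called inner if there are $0 \neq c \in A$ and $c_l \in A$ with $c_l\circ c = 1$ and $G(x) = (c_l\circ x)\circ c$ for all $x\in A$. There are $e \in F$ and a root $d\in K$ of $x^m-e$ such that $x^m-e$ is irreducible in $F[x]$ and $K=F(d)$. Moreover, for every $d\in K$ with $K=F(d)$ and $d^m\in F$, and every $a\in K\setminus F$: (i) If $a\neq\lambda d^i$ for all $\lambda\in F^\times$ and $i\in\{0,\dots,m-1\}$, then for every generator $\alpha$ of $K^\times$ the map $G_\alpha : x \mapsto (\alpha^{-1}\circ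 x)\circ\alpha$ is an automorphism of $A$ and $\mathrm{Aut}_F(A)=\langle G_\alpha\rangle\cong \mathbb{Z}/s\mathbb{Z}$; moreover all automorphisms of $A$ are inner. (ii) If $m=2$ and $a=\lambda d$ for some $\lambda\in F^\times$, then $\mathrm{Aut}_F(A)$ is isomorphic to the dicyclic group of order $2q+2$, that is, to $\langle x,y \mid y^{2l}=1,\ x^2=y^l,\ x^{-1}yx=y^{-1}\rangle$ with $l=(q+1)/2$. (iii) If $m>2$ and $a=\lambda d^i$ for some $i\in\{1,\dots,m-1\}$ and $\lambda\in F^\times$, then $$\mathrm{Aut}_F(A)\cong \mathbb{Z}/(s/m)\mathbb{Z}\rtimes_q \mathbb{Z}/m^2\mathbb{Z},$$ the semidirect product in which the generator $1$ of $\mathbb{Z}/m^2\mathbb{Z}$ acts on $\mathbb{Z}/(s/m)\mathbb{Z}$ as multiplication by $q$ (here $m \mid s$ and $q^{m^2}\equiv 1 \pmod{s/m}$, so this makes sense). -/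

import Mathlib

open scoped IntermediateField

noncomputable section

namespace NonassocCyclic

variable {F K : Type*} [Field F] [Field K] [Algebra F K]

/-- The twisted polynomial ring `K[t;σ]`, with multiplication determined by `t c = σ(c) t`.
It is Mathlib's skew polynomial ring, for the action of `ℕ` on `K` through the powers of `σ`. -/
def TwistedPoly (_σ : K ≃ₐ[F] K) : Type _ := SkewPolynomial K

namespace TwistedPoly

/-- `n` acts on `K` as `σ ^ n`. -/
abbrev twist (σ : K ≃ₐ[F] K) : MulSemiringAction (Multiplicative ℕ) K :=
  MulSemiringAction.compHom K (powersHom (K ≃ₐ[F] K) σ)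

instance (σ : K ≃ₐ[F] K) : Ring (TwistedPoly σ) :=
  letI := twist σ
  inferInstanceAs (Ring (SkewPolynomial K))

instance (σ : K ≃ₐ[F] K) : Module F (TwistedPoly σ) :=
  inferInstanceAs (Module F (SkewPolynomial K))

/-- The monomial `c t ^ n`. -/
def monomial (σ : K ≃ₐ[F] K) (n : ℕ) (c : K) : TwistedPoly σ :=
  SkewPolynomial.monomial n c

/-- The coefficient of `t ^ n`. -/
def coeff {σ : K ≃ₐ[F] K} (g : TwistedPoly σ) (n : ℕ) : K :=
  SkewPolynomial.coeff g n

variable {σ : K ≃ₐ[F] K}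

theorem ext {g h : TwistedPoly σ} (H : ∀ n, coeff g n = coeff h n) : g = h := by
  apply SkewMonoidAlgebra.ext
  intro n
  exact H (Multiplicative.toAdd n)

theorem coeff_add (g h : TwistedPoly σ) (n : ℕ) :
    coeff (g + h) n = coeff g n + coeff h n := by
  exact DFunLike.congr_fun (SkewMonoidAlgebra.coeff_add (k := K) (G := Multiplicative ℕ) g h)
    (Multiplicative.ofAdd n)

theorem coeff_zero (n : ℕ) : coeff (0 : TwistedPoly σ) n = 0 := rfl

theorem coeff_smul (b : F) (g : TwistedPoly σ) (n : ℕ) :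
    coeff (b • g) n = b • coeff g n := rfl

theorem coeff_monomial (n k : ℕ) (c : K) :
    coeff (monomial σ n c) k = if n = k then c else 0 :=
  SkewPolynomial.coeff_monomial

theorem one_eq : (1 : TwistedPoly σ) = monomial σ 0 1 := rfl

theorem monomial_add (n : ℕ) (b c : K) :
    monomial σ n (b + c) = monomial σ n b + monomial σ n c :=
  SkewPolynomial.monomial_add n b c

theorem monomial_mul_monomial (i j : ℕ) (b c : K) :
    monomial σ i b * monomial σ j c = monomial σ (i + j) (b * (σ ^ i) c) := by
  let _ := twist σ
  exact SkewMonoidAlgebra.single_mul_single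

theorem induction {P : TwistedPoly σ → Prop} (h0 : P 0) (hm : ∀ n c, P (monomial σ n c))
    (ha : ∀ g h, P g → P h → P (g + h)) (g : TwistedPoly σ) : P g :=
  SkewPolynomial.induction (motive := P) g h0 fun n r _ _ _ hq => ha _ _ (hm n r) hq

theorem smul_monomial (b : F) (n : ℕ) (c : K) :
    b • monomial σ n c = monomial σ n (b • c) :=
  SkewMonoidAlgebra.smul_single _ _ _

theorem smul_mul (b : F) (g h : TwistedPoly σ) : (b • g) * h = b • (g * h) := by
  induction g using induction with
  | h0 => simp
  | ha g g' hg hg' => simp [add_mul, smul_add, hg, hg']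
  | hm i x =>
    induction h using induction with
    | h0 => simp
    | ha g g' hg hg' => simp [mul_add, smul_add, hg, hg']
    | hm j y => simp [smul_monomial, monomial_mul_monomial]

theorem mul_smul (b : F) (g h : TwistedPoly σ) : g * (b • h) = b • (g * h) := by
  induction g using induction with
  | h0 => simp
  | ha g g' hg hg' => simp [add_mul, smul_add, hg, hg']
  | hm i x =>
    induction h using induction with
    | h0 => simp
    | ha g g' hg hg' => simp [mul_add, smul_add, hg, hg']
    | hm j y => simp [smul_monomial, monomial_mul_monomial]

/-- The polynomial `t ^ m - a`. -/
def binomial (σ : K ≃ₐ[F] K) (m : ℕ) (a : K) : TwistedPoly σ :=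
  monomial σ m 1 - monomial σ 0 a

/-- The polynomials of degree less than `m`. -/
def degreeLT (σ : K ≃ₐ[F] K) (m : ℕ) : Submodule F (TwistedPoly σ) where
  carrier := {g | ∀ n, m ≤ n → coeff g n = 0}
  add_mem' hg hh n hn := by rw [coeff_add, hg n hn, hh n hn, add_zero]
  zero_mem' n _ := coeff_zero n
  smul_mem' b g hg n hn := by rw [coeff_smul, hg n hn, smul_zero]

theorem mem_degreeLT {m : ℕ} {g : TwistedPoly σ} :
    g ∈ degreeLT σ m ↔ ∀ n, m ≤ n → coeff g n = 0 := Iff.rfl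

theorem monomial_mem {m i : ℕ} (hi : i < m) (c : K) : monomial σ i c ∈ degreeLT σ m := by
  intro n hn
  rw [coeff_monomial, if_neg (by omega)]

theorem monomial_eq (m n : ℕ) (a c : K) :
    monomial σ (n + m) c =
      monomial σ n c * binomial σ m a + monomial σ n (c * (σ ^ n) a) := by
  simp [binomial, mul_sub, monomial_mul_monomial]

theorem coeff_mul_binomial (m k : ℕ) (a : K) (q : TwistedPoly σ) :
    coeff (q * binomial σ m a) (k + m) =
      coeff q k - coeff q (k + m) * (σ ^ (k + m)) a := by
  induction q using induction with
  | h0 => simp [coeff_zero]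
  | ha g h hg hh => rw [add_mul, coeff_add, hg, hh, coeff_add, coeff_add]; ring
  | hm n c =>
    have e := coeff_add (monomial σ n c * binomial σ m a) (monomial σ n (c * (σ ^ n) a)) (k + m)
    rw [← monomial_eq, coeff_monomial, coeff_monomial] at e
    rw [coeff_monomial, coeff_monomial, eq_sub_of_add_eq e.symm]
    by_cases h : n = k + m
    · simp [h]
    · simp [h]

theorem eq_zero_of_mul_binomial_mem {m : ℕ} (hm : 0 < m) (a : K) (q : TwistedPoly σ)
    (h : q * binomial σ m a ∈ degreeLT σ m) : q = 0 := by
  have step : ∀ k, coeff q k = coeff q (k + m) * (σ ^ (k + m)) a := fun k => by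
    have := h (k + m) (by omega)
    rw [coeff_mul_binomial] at this
    exact sub_eq_zero.mp this
  obtain ⟨N, hN⟩ : ∃ N, ∀ n, N ≤ n → coeff q n = 0 := by
    refine ⟨(SkewPolynomial.support (R := K) q).sup id + 1, fun n hn => ?_⟩
    by_contra hne
    have h1 : id n ≤ (SkewPolynomial.support (R := K) q).sup id :=
      Finset.le_sup (SkewPolynomial.mem_support_iff.mpr hne)
    simp only [id] at h1 hn
    omega
  have all : ∀ j k, N ≤ k + j → coeff q k = 0 := by
    intro j
    induction j using Nat.strong_induction_on with
    | _ j ih =>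
      intro k hk
      by_cases hj : j = 0
      · exact hN k (by omega)
      · rw [step k, ih (j - 1) (by omega) (k + m) (by omega), zero_mul]
  exact ext fun k => all N k (by omega)

/-- Right division by `t ^ m - a`: the remainder exists and is unique. -/
theorem existsUnique_remainder {m : ℕ} (hm : 0 < m) (a : K) (g : TwistedPoly σ) :
    ∃! r : degreeLT σ m, ∃ q : TwistedPoly σ, g = q * binomial σ m a + r := by
  have ex : ∃ r : degreeLT σ m, ∃ q : TwistedPoly σ, g = q * binomial σ m a + r := by
    induction g using induction with
    | h0 => exact ⟨0, 0, by simp⟩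
    | ha g h hg hh =>
      obtain ⟨r, q, e⟩ := hg
      obtain ⟨r', q', e'⟩ := hh
      refine ⟨r + r', q + q', ?_⟩
      rw [e, e', add_mul, Submodule.coe_add]
      abel
    | hm n c =>
      induction n using Nat.strong_induction_on generalizing c with
      | _ n ih =>
        by_cases hn : n < m
        · exact ⟨⟨_, monomial_mem hn c⟩, 0, by simp⟩
        · obtain ⟨n, rfl⟩ := Nat.exists_eq_add_of_le' (not_lt.mp hn)
          obtain ⟨r, q, e⟩ := ih n (by omega) (c * (σ ^ n) a)
          refine ⟨r, monomial σ n c + q, ?_⟩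
          rw [monomial_eq m n a c, e, add_mul]
          abel
  obtain ⟨r, q, e⟩ := ex
  refine ⟨r, ⟨q, e⟩, ?_⟩
  rintro r' ⟨q', e'⟩
  have key : (q - q') * binomial σ m a = (r' : TwistedPoly σ) - r := by
    rw [sub_mul, sub_eq_sub_iff_add_eq_add, ← e, e']
    abel
  have hz := eq_zero_of_mul_binomial_mem hm a (q - q') (key ▸ (r' - r).2)
  rw [hz, zero_mul] at key
  exact Subtype.ext (sub_eq_zero.mp key.symm)

/-- The remainder of `g` after right division by `t ^ m - a`. -/
def remainder (m : ℕ) [NeZero m] (a : K) (g : TwistedPoly σ) : degreeLT σ m :=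
  (existsUnique_remainder (NeZero.pos m) a g).choose

theorem remainder_spec (m : ℕ) [NeZero m] (a : K) (g : TwistedPoly σ) :
    ∃ q : TwistedPoly σ, g = q * binomial σ m a + remainder m a g :=
  (existsUnique_remainder (NeZero.pos m) a g).choose_spec.1

theorem remainder_eq {m : ℕ} [NeZero m] {a : K} {g : TwistedPoly σ} {r : degreeLT σ m}
    (q : TwistedPoly σ) (h : g = q * binomial σ m a + r) : remainder m a g = r :=
  ((existsUnique_remainder (NeZero.pos m) a g).choose_spec.2 r ⟨q, h⟩).symm

theorem remainder_coe {m : ℕ} [NeZero m] (a : K) (r : degreeLT σ m) :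
    remainder m a (r : TwistedPoly σ) = r :=
  remainder_eq 0 (by simp)

theorem remainder_zero (m : ℕ) [NeZero m] (a : K) :
    remainder m a (0 : TwistedPoly σ) = 0 :=
  remainder_eq 0 (by simp)

theorem remainder_add (m : ℕ) [NeZero m] (a : K) (g h : TwistedPoly σ) :
    remainder m a (g + h) = remainder m a g + remainder m a h := by
  obtain ⟨q, e⟩ := remainder_spec m a g
  obtain ⟨q', e'⟩ := remainder_spec m a h
  refine remainder_eq (q + q') ?_
  rw [add_mul, Submodule.coe_add]
  nth_rewrite 1 [e, e']
  abel

theorem remainder_smul (m : ℕ) [NeZero m] (a : K) (b : F) (g : TwistedPoly σ) :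
    remainder m a (b • g) = b • remainder m a g := by
  obtain ⟨q, e⟩ := remainder_spec m a g
  refine remainder_eq (b • q) ?_
  rw [smul_mul, Submodule.coe_smul, ← smul_add, ← e]

end TwistedPoly

open TwistedPoly

/-- The nonassociative cyclic algebra `(K/F, σ, a) = K[t;σ] / K[t;σ](t ^ m - a)` of degree `m`:
the polynomials of degree less than `m`, where the product of `g` and `h` is the remainder of
`g h` after right division by `t ^ m - a`. -/
def Alg (σ : K ≃ₐ[F] K) (m : ℕ) (_a : K) : Type _ := degreeLT σ m

namespace Alg

variable (σ : K ≃ₐ[F] K) (m : ℕ) (a : K)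

instance : AddCommGroup (Alg σ m a) := inferInstanceAs (AddCommGroup (degreeLT σ m))

instance : Module F (Alg σ m a) := inferInstanceAs (Module F (degreeLT σ m))

variable {σ m a} in
/-- The underlying twisted polynomial. -/
def toPoly (x : Alg σ m a) : TwistedPoly σ := Subtype.val (p := (· ∈ degreeLT σ m)) x

variable [NeZero m]

instance : Mul (Alg σ m a) where
  mul x y := remainder m a (toPoly x * toPoly y)

/-- The element `c` of `K`, as a polynomial of degree `0`. -/
def const (c : K) : Alg σ m a :=
  (⟨monomial σ 0 c, monomial_mem (NeZero.pos m) c⟩ : degreeLT σ m)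

instance : One (Alg σ m a) where
  one := const σ m a 1

variable {σ m a} in
theorem mul_eq (x y : Alg σ m a) :
    x * y = (remainder m a (toPoly x * toPoly y) : degreeLT σ m) := rfl

instance : NonAssocRing (Alg σ m a) where
  left_distrib x y z := by
    rw [mul_eq, mul_eq, mul_eq]
    exact (congrArg _ (mul_add (toPoly x) (toPoly y) (toPoly z))).trans (remainder_add m a _ _)
  right_distrib x y z := by
    rw [mul_eq, mul_eq, mul_eq]
    exact (congrArg _ (add_mul (toPoly x) (toPoly y) (toPoly z))).trans (remainder_add m a _ _)
  zero_mul x := by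
    rw [mul_eq]
    exact (congrArg _ (zero_mul (toPoly x))).trans (remainder_zero m a)
  mul_zero x := by
    rw [mul_eq]
    exact (congrArg _ (mul_zero (toPoly x))).trans (remainder_zero m a)
  one_mul x := by
    rw [mul_eq]
    exact (congrArg _ (one_mul (toPoly x))).trans (remainder_coe a _)
  mul_one x := by
    rw [mul_eq]
    exact (congrArg _ (mul_one (toPoly x))).trans (remainder_coe a _)

instance : IsScalarTower F (Alg σ m a) (Alg σ m a) where
  smul_assoc b x y := by
    rw [smul_eq_mul, smul_eq_mul, mul_eq, mul_eq]
    exact (congrArg _ (smul_mul b (toPoly x) (toPoly y))).trans (remainder_smul m a b _)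

instance : SMulCommClass F (Alg σ m a) (Alg σ m a) where
  smul_comm b x y := by
    rw [smul_eq_mul, smul_eq_mul, mul_eq, mul_eq]
    exact ((congrArg _ (mul_smul b (toPoly x) (toPoly y))).trans (remainder_smul m a b _)).symm

end Alg

/-- The group `Aut_F(A)` of `F`-algebra automorphisms of a nonassociative algebra `A`, under
composition. (A bijective multiplicative map preserves the unit element, if there is one.) -/
def AlgAut (F A : Type*) [Field F] [NonAssocRing A] [Module F A] : Subgroup (A ≃ₗ[F] A) where
  carrier := {G | ∀ x y, G (x * y) = G x * G y}
  mul_mem' {G H} hG hH x y := by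
    rw [LinearEquiv.mul_apply, LinearEquiv.mul_apply, LinearEquiv.mul_apply, hH x y, hG]
  one_mem' x y := rfl
  inv_mem' {G} hG x y := by
    apply G.injective
    have h : ∀ z, G (G⁻¹ z) = z := fun z => G.apply_symm_apply z
    rw [hG, h, h, h]

/-- An automorphism `G` is inner if there are an element `c ≠ 0` and a left inverse `c'` of `c`
such that `G x = (c' x) c` for all `x`. -/
def IsInner {F A : Type*} [Field F] [NonAssocRing A] [Module F A] (G : AlgAut F A) : Prop :=
  ∃ c c' : A, c ≠ 0 ∧ c' * c = 1 ∧ ∀ x : A, (G : A ≃ₗ[F] A) x = (c' * x) * c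

end NonassocCyclic

end

open NonassocCyclic

/-! Since `a` is not in `F`, the left nucleus of `A` is `K`, so an automorphism `G` restricts to
some `τ` in the Galois group. Comparing `G(t c)` with `G(σ(c) t)` forces `G(t) = k t`, and the
relation `t ∘ t^(m-1) = a` gives `τ(a) = N(k) a`. Conversely, for such a pair the substitution `∑ xₙ
tⁿ ↦ ∑ τ(xₙ) (k t)ⁿ` sends `t^m - a` to `N(k) (t^m - a)`, hence descends to `A`. So the automorphism
group is the group of pairs `(k, τ)` inside `Kˣ ⋊ Gal(K/F)` (`exists_mulEquiv_algAut`), and only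
this group remains to be determined.

If some `τ ≠ 1` occurs, `a` is an eigenvector of `τ` whose eigenvalue is an `m`-th root of unity in
`F`, and Kummer theory gives `a = λ d^i` (`exists_eq_mul_pow_of_apply_eq`). In case (i), therefore,
only the `s` elements `k` of norm one remain. By Hilbert 90 each is `σ(b)/b`, its automorphism is
conjugation by `b`, and a generator `b` of `Kˣ` gives a generator.

In the other cases `a^m` lies in `F`. The Frobenius `φ` multiplies `a` by a nontrivial `m`-th root
of unity, which lies in `F` because `m ∣ q - 1` and so is a norm `N(k)`. The pair `(k, φ)` has
`m`-th power `(N(k), 1)`, hence order `m²`. For `m > 2`, `m` divides `s` exactly once, so a pair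
`(ω, 1)` with `ω` of order `s/m` has order prime to `m²`, and `(k, φ)` acts on it by `q`-th powers.
For `m = 2` take `ω` of order `q + 1`; then `(k, φ)² = (-1, 1) = (ω, 1)^((q+1)/2)`. The bound `s m`
on the number of pairs (`card_pairGroup_le`) shows that nothing else occurs. -/

namespace NonassocCyclic

variable {F K : Type*} [Field F] [Field K] [Algebra F K]

/-! ### Semilinear substitutions `t ↦ k t` in the twisted polynomial ring -/

namespace TwistedPoly

variable {σ : K ≃ₐ[F] K}

/-- The map `∑ xₙ tⁿ ↦ ∑ τ(xₙ) uₙ tⁿ` on twisted polynomials, as a function. -/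
noncomputable def twistFun (τ : K ≃ₐ[F] K) (u : ℕ → K) (g : TwistedPoly σ) : TwistedPoly σ :=
  (⟨Finsupp.onFinset (SkewMonoidAlgebra.support (k := K) (G := Multiplicative ℕ) g)
    (fun n => τ (coeff g n.toAdd) * u n.toAdd) fun n hn =>
      SkewMonoidAlgebra.mem_support_iff.mpr fun h =>
        hn (by rw [show coeff g n.toAdd = 0 from h, map_zero, zero_mul])⟩ :
    SkewMonoidAlgebra K (Multiplicative ℕ))

theorem coeff_twistFun (τ : K ≃ₐ[F] K) (u : ℕ → K) (g : TwistedPoly σ) (n : ℕ) :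
    coeff (twistFun τ u g) n = τ (coeff g n) * u n := rfl

/-- The map `∑ xₙ tⁿ ↦ ∑ τ(xₙ) uₙ tⁿ` on twisted polynomials. -/
noncomputable def twistMap (τ : K ≃ₐ[F] K) (u : ℕ → K) : TwistedPoly σ →ₗ[F] TwistedPoly σ where
  toFun := twistFun τ u
  map_add' g h := ext fun n => by
    simp only [coeff_add, coeff_twistFun, map_add, add_mul]
  map_smul' b g := ext fun n => by
    simp only [coeff_smul, coeff_twistFun, map_smul, smul_mul_assoc, RingHom.id_apply]

theorem coeff_twistMap (τ : K ≃ₐ[F] K) (u : ℕ → K) (g : TwistedPoly σ) (n : ℕ) :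
    coeff (twistMap τ u g) n = τ (coeff g n) * u n := rfl

theorem twistMap_monomial (τ : K ≃ₐ[F] K) (u : ℕ → K) (n : ℕ) (c : K) :
    twistMap τ u (monomial σ n c) = monomial σ n (τ c * u n) := by
  refine ext fun k => ?_
  rw [coeff_twistMap, coeff_monomial, coeff_monomial]
  split_ifs with h
  · rw [h]
  · rw [map_zero, zero_mul]

/-- The product `k σ(k) ⋯ σⁿ⁻¹(k)`, which is the coefficient of `(k t) ^ n`. -/
def twistProd (σ : K ≃ₐ[F] K) (k : K) (n : ℕ) : K := ∏ l ∈ Finset.range n, (σ ^ l) k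

theorem twistProd_zero (k : K) : twistProd σ k 0 = 1 := by simp [twistProd]

theorem twistProd_one (k : K) : twistProd σ k 1 = k := by simp [twistProd]

theorem twistProd_add (k : K) (i j : ℕ) :
    twistProd σ k (i + j) = twistProd σ k i * (σ ^ i) (twistProd σ k j) := by
  simp only [twistProd, Finset.prod_range_add, map_prod, pow_add, AlgEquiv.mul_apply]

theorem twistProd_ne_zero {k : K} (hk : k ≠ 0) (n : ℕ) : twistProd σ k n ≠ 0 :=
  Finset.prod_ne_zero_iff.mpr fun l _ => (map_ne_zero (σ ^ l)).mpr hk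

theorem twistProd_mul (k l : K) (n : ℕ) :
    twistProd σ (k * l) n = twistProd σ k n * twistProd σ l n := by
  simp [twistProd, Finset.prod_mul_distrib]

theorem map_twistProd {τ : K ≃ₐ[F] K} (h : Commute τ σ) (k : K) (n : ℕ) :
    τ (twistProd σ k n) = twistProd σ (τ k) n := by
  simp only [twistProd, map_prod]
  refine Finset.prod_congr rfl fun l _ => ?_
  exact DFunLike.congr_fun (h.pow_right l).eq k

/-- With these factors the map is the substitution `t ↦ k t` with `τ` applied to the coefficients.
Multiplicativity is the cocycle identity `twistProd_add` together with `τ σ = σ τ`. -/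
theorem twistMap_mul {τ : K ≃ₐ[F] K} (hτ : Commute τ σ) (k : K) (g h : TwistedPoly σ) :
    twistMap τ (twistProd σ k) (g * h) =
      twistMap τ (twistProd σ k) g * twistMap τ (twistProd σ k) h := by
  induction g using induction with
  | h0 => simp
  | ha g g' hg hg' => simp [add_mul, hg, hg']
  | hm i x =>
    induction h using induction with
    | h0 => simp
    | ha g g' hg hg' => simp [mul_add, hg, hg']
    | hm j y =>
      have e : τ ((σ ^ i) y) = (σ ^ i) (τ y) := DFunLike.congr_fun (hτ.pow_right i).eq y
      simp only [monomial_mul_monomial, twistMap_monomial, twistProd_add, map_mul, e]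
      congr 1
      ring

/-- The left ideal generated by `t^m - a` is thus mapped into itself, which is what lets the
substitution descend to the algebra. -/
theorem twistMap_binomial {τ : K ≃ₐ[F] K} {k a : K} {m : ℕ}
    (h : τ a = twistProd σ k m * a) :
    twistMap τ (twistProd σ k) (binomial σ m a) =
      monomial σ 0 (twistProd σ k m) * binomial σ m a := by
  simp [binomial, twistMap_monomial, mul_sub, monomial_mul_monomial, twistProd_zero, h]

theorem twistMap_mem {τ : K ≃ₐ[F] K} {u : ℕ → K} {m : ℕ} {g : TwistedPoly σ}
    (hg : g ∈ degreeLT σ m) : twistMap τ u g ∈ degreeLT σ m := fun n hn => by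
  rw [coeff_twistMap, hg n hn, map_zero, zero_mul]

end TwistedPoly

open TwistedPoly

/-! ### Multiplication in the algebra and its left nucleus -/

namespace Alg

variable {σ : K ≃ₐ[F] K} {m : ℕ} {a : K}

/-- The coefficient of `t ^ n` in an element of the algebra. -/
def coeff (x : Alg σ m a) (n : ℕ) : K := TwistedPoly.coeff (toPoly x) n

theorem coeff_eq_zero (x : Alg σ m a) {n : ℕ} (hn : m ≤ n) : coeff x n = 0 := x.2 n hn

theorem ext {x y : Alg σ m a} (h : ∀ n < m, coeff x n = coeff y n) : x = y :=
  Subtype.ext (TwistedPoly.ext fun n => by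
    by_cases hn : n < m
    · exact h n hn
    · exact (coeff_eq_zero x (not_lt.mp hn)).trans (coeff_eq_zero y (not_lt.mp hn)).symm)

theorem coeff_add (x y : Alg σ m a) (n : ℕ) : coeff (x + y) n = coeff x n + coeff y n :=
  TwistedPoly.coeff_add (toPoly x) (toPoly y) n

theorem coeff_smul (b : F) (x : Alg σ m a) (n : ℕ) : coeff (b • x) n = b • coeff x n :=
  TwistedPoly.coeff_smul b (toPoly x) n

theorem coeff_zero (n : ℕ) : coeff (0 : Alg σ m a) n = 0 := rfl

/-- The map `∑ xₙ tⁿ ↦ ∑ τ(xₙ) k σ(k) ⋯ σⁿ⁻¹(k) tⁿ`. -/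
noncomputable def twistEquiv (σ : K ≃ₐ[F] K) (m : ℕ) (a : K) (τ : K ≃ₐ[F] K) (k : Kˣ) :
    Alg σ m a ≃ₗ[F] Alg σ m a :=
  let f (τ : K ≃ₐ[F] K) (u : ℕ → K) : degreeLT σ m →ₗ[F] degreeLT σ m :=
    (twistMap τ u).restrict fun _ => twistMap_mem
  LinearEquiv.ofLinearMap (f τ (twistProd σ k)) (f τ⁻¹ fun n => τ⁻¹ (twistProd σ k n)⁻¹)
    (LinearMap.ext fun x => Subtype.ext <| TwistedPoly.ext fun n => by
      change τ (τ⁻¹ (TwistedPoly.coeff x.1 n) * τ⁻¹ (twistProd σ k n)⁻¹) * twistProd σ k n =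
        TwistedPoly.coeff x.1 n
      rw [← map_mul, show τ (τ⁻¹ _) = _ from τ.apply_symm_apply _, mul_assoc,
        inv_mul_cancel₀ (twistProd_ne_zero k.ne_zero n), mul_one])
    (LinearMap.ext fun x => Subtype.ext <| TwistedPoly.ext fun n => by
      change τ⁻¹ (τ (TwistedPoly.coeff x.1 n) * twistProd σ k n) * τ⁻¹ (twistProd σ k n)⁻¹ =
        TwistedPoly.coeff x.1 n
      rw [← map_mul, mul_assoc, mul_inv_cancel₀ (twistProd_ne_zero k.ne_zero n), mul_one,
        show τ⁻¹ (τ _) = _ from τ.symm_apply_apply _])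

theorem coeff_twistEquiv (τ : K ≃ₐ[F] K) (k : Kˣ) (x : Alg σ m a) (n : ℕ) :
    coeff (twistEquiv σ m a τ k x) n = τ (coeff x n) * twistProd σ k n := rfl

variable [NeZero m]

variable (σ m a) in
/-- The residue of `c t ^ i`. -/
noncomputable def monom (i : ℕ) (c : K) : Alg σ m a :=
  (remainder m a (monomial σ i c) : degreeLT σ m)

theorem toPoly_monom {i : ℕ} (hi : i < m) (c : K) :
    toPoly (monom σ m a i c) = monomial σ i c :=
  congrArg Subtype.val (remainder_coe a ⟨monomial σ i c, monomial_mem hi c⟩)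

theorem coeff_monom {i : ℕ} (hi : i < m) (c : K) (n : ℕ) :
    coeff (monom σ m a i c) n = if i = n then c else 0 := by
  rw [coeff, toPoly_monom hi, coeff_monomial]

/-- Modulo `t^m - a` a right factor `t^m` may be replaced by `a`, and moving `a` to the left past
`t^n` applies `σ^n`. -/
theorem monom_add_degree (n : ℕ) (c : K) :
    monom σ m a (n + m) c = monom σ m a n (c * (σ ^ n) a) := by
  obtain ⟨q, e⟩ := remainder_spec m a (monomial σ n (c * (σ ^ n) a))
  refine remainder_eq (monomial σ n c + q) ?_
  rw [monomial_eq m n a c, add_mul, add_assoc]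
  congr 1

theorem const_eq_monom (c : K) : const σ m a c = monom σ m a 0 c :=
  (remainder_coe a ⟨monomial σ 0 c, monomial_mem (NeZero.pos m) c⟩).symm

theorem monom_mul_monom {i j : ℕ} (hi : i < m) (hj : j < m) (b c : K) :
    monom σ m a i b * monom σ m a j c = monom σ m a (i + j) (b * (σ ^ i) c) := by
  rw [mul_eq, toPoly_monom hi, toPoly_monom hj, monomial_mul_monomial]
  rfl

theorem coeff_sum {ι : Type*} (s : Finset ι) (f : ι → Alg σ m a) (n : ℕ) :
    coeff (∑ i ∈ s, f i) n = ∑ i ∈ s, coeff (f i) n := by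
  classical
  induction s using Finset.induction_on with
  | empty => simp [coeff_zero]
  | insert i s hi ih => rw [Finset.sum_insert hi, Finset.sum_insert hi, coeff_add, ih]

theorem eq_sum_monom (x : Alg σ m a) : x = ∑ i ∈ Finset.range m, monom σ m a i (coeff x i) := by
  refine ext fun n hn => ?_
  rw [coeff_sum, Finset.sum_congr rfl fun i hi => coeff_monom (Finset.mem_range.mp hi) _ n]
  simp [hn]

theorem induction {P : Alg σ m a → Prop} (h0 : P 0) (hm : ∀ i < m, ∀ c, P (monom σ m a i c))
    (ha : ∀ x y, P x → P y → P (x + y)) (x : Alg σ m a) : P x := by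
  rw [eq_sum_monom x]
  exact Finset.sum_induction _ P ha h0 fun i hi => hm i (Finset.mem_range.mp hi) _

theorem coeff_const_mul (c : K) (x : Alg σ m a) (n : ℕ) :
    coeff (const σ m a c * x) n = c * coeff x n := by
  induction x using induction with
  | h0 => simp [coeff_zero]
  | ha x y hx hy => rw [mul_add, coeff_add, hx, hy, coeff_add, mul_add]
  | hm i hi b =>
    rw [const_eq_monom, monom_mul_monom (NeZero.pos m) hi, zero_add, coeff_monom hi,
      coeff_monom hi]
    simp

theorem coeff_mul_const (c : K) (x : Alg σ m a) (n : ℕ) :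
    coeff (x * const σ m a c) n = coeff x n * (σ ^ n) c := by
  induction x using induction with
  | h0 => simp [coeff_zero]
  | ha x y hx hy => rw [add_mul, coeff_add, hx, hy, coeff_add, add_mul]
  | hm i hi b =>
    rw [const_eq_monom, monom_mul_monom hi (NeZero.pos m), add_zero, coeff_monom hi,
      coeff_monom hi]
    by_cases h : i = n <;> simp [h]

theorem coeff_const (c : K) (n : ℕ) : coeff (const σ m a c) n = if 0 = n then c else 0 := by
  rw [const_eq_monom, coeff_monom (NeZero.pos m)]

/-- The multiples of `t^m - a` form a left ideal, so left multiplication by a constant commutes with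
taking remainders. Hence `K` lies in the left nucleus. -/
theorem const_mul_assoc (c : K) (x y : Alg σ m a) :
    (const σ m a c * x) * y = const σ m a c * (x * y) := by
  induction x using induction with
  | h0 => simp
  | ha x x' hx hx' => simp only [mul_add, add_mul, hx, hx']
  | hm i hi b =>
    induction y using induction with
    | h0 => simp
    | ha y y' hy hy' => rw [mul_add, mul_add, mul_add, hy, hy']
    | hm j hj d =>
      rw [const_eq_monom, monom_mul_monom (NeZero.pos m) hi, zero_add, monom_mul_monom hi hj,
        monom_mul_monom hi hj]
      by_cases h : i + j < m
      · rw [monom_mul_monom (NeZero.pos m) h, zero_add]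
        simp [mul_assoc]
      · obtain ⟨l, hl⟩ := Nat.exists_eq_add_of_le' (not_lt.mp h)
        rw [hl, monom_add_degree, monom_add_degree,
          monom_mul_monom (NeZero.pos m) (show l < m by omega), zero_add]
        simp [mul_assoc]

/-- The coefficients at positive degree of `(x tᵐ⁻¹) t`. -/
theorem coeff_mul_monom_mul_monom (hm : 1 < m) (x : Alg σ m a) (n : ℕ) :
    coeff ((x * monom σ m a (m - 1) 1) * monom σ m a 1 1) (n + 1) =
      coeff x (n + 1) * (σ ^ n) a := by
  induction x using induction with
  | h0 => simp [coeff_zero]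
  | ha x x' hx hx' => rw [add_mul, add_mul, coeff_add, hx, hx', coeff_add, add_mul]
  | hm i hi b =>
    rw [monom_mul_monom hi (by omega), map_one, mul_one]
    cases i with
    | zero =>
      rw [zero_add, monom_mul_monom (by omega) hm, map_one, mul_one,
        show m - 1 + 1 = 0 + m by omega, monom_add_degree, coeff_monom (NeZero.pos m),
        coeff_monom (NeZero.pos m)]
      simp
    | succ i =>
      rw [show i + 1 + (m - 1) = i + m by omega, monom_add_degree,
        monom_mul_monom (by omega) hm, map_one, mul_one, coeff_monom hi, coeff_monom hi]
      by_cases h : i = n <;> simp [h]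

theorem monom_mul_monom_eq_const (hm : 1 < m) :
    monom σ m a (m - 1) 1 * monom σ m a 1 1 = const σ m a a := by
  rw [monom_mul_monom (by omega) hm, map_one, mul_one, show m - 1 + 1 = 0 + m by omega,
    monom_add_degree, const_eq_monom]
  simp

/-- The left nucleus of the algebra is `K`. -/
theorem eq_const_of_mul_assoc (hm : 1 < m) (ha : σ a ≠ a) {x : Alg σ m a}
    (hx : ∀ y z, (x * y) * z = x * (y * z)) : x = const σ m a (coeff x 0) := by
  refine ext fun n _ => ?_
  rw [coeff_const]
  cases n with
  | zero => simp
  | succ n =>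
    -- Associativity on `t^(m-1)` and `t`, whose product is `a`, compares `xₙ₊₁ σⁿ(a)` with `xₙ₊₁
    -- σⁿ⁺¹(a)`.
    have h := congrArg (coeff · (n + 1)) (hx (monom σ m a (m - 1) 1) (monom σ m a 1 1))
    simp only [coeff_mul_monom_mul_monom hm, monom_mul_monom_eq_const hm, coeff_mul_const] at h
    rw [if_neg (by omega)]
    by_contra hne
    have h' := mul_left_cancel₀ hne h
    rw [pow_succ, AlgEquiv.mul_apply] at h'
    exact ha ((σ ^ n).injective h').symm

/-- Applying the substitution to the division of `x y` by `t^m - a` gives a division of the product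
of the images, and remainders are unique. -/
theorem twistEquiv_mem {τ : K ≃ₐ[F] K} {k : Kˣ} (hτ : Commute τ σ)
    (h : τ a = twistProd σ k m * a) : twistEquiv σ m a τ k ∈ AlgAut F (Alg σ m a) := by
  intro x y
  obtain ⟨q, e⟩ := remainder_spec m a (toPoly x * toPoly y)
  symm
  rw [mul_eq]
  refine remainder_eq (r := (twistEquiv σ m a τ k (x * y)))
    (twistMap τ (twistProd σ k) q * monomial σ 0 (twistProd σ k m)) ?_
  have e' := congrArg (twistMap τ (twistProd σ k)) e
  rw [map_add, twistMap_mul hτ, twistMap_mul hτ, twistMap_binomial h, ← mul_assoc] at e'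
  exact e'

end Alg

/-! ### The shape of an arbitrary automorphism -/

open Alg

theorem AlgAut.map_one {A : Type*} [NonAssocRing A] [Module F A] (G : AlgAut F A) :
    (G : A ≃ₗ[F] A) 1 = 1 := by
  obtain ⟨y, hy⟩ := (G : A ≃ₗ[F] A).surjective 1
  have h := G.2 y 1
  rw [mul_one, hy, one_mul] at h
  exact h.symm

/-- Every automorphism is of the form `∑ xₙ tⁿ ↦ ∑ τ(xₙ) (k t)ⁿ`. -/
theorem AlgAut.exists_eq_twistEquiv [FiniteDimensional F K] {σ : K ≃ₐ[F] K} {m : ℕ} [NeZero m]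
    {a : K} (hm : 1 < m) (hσ : orderOf σ = m) (hcomm : ∀ τ, Commute τ σ) (ha : σ a ≠ a)
    (G : AlgAut F (Alg σ m a)) :
    ∃ (τ : K ≃ₐ[F] K) (k : Kˣ), τ a = twistProd σ k m * a ∧
      (G : Alg σ m a ≃ₗ[F] Alg σ m a) = twistEquiv σ m a τ k := by
  have hG := G.2
  have hG1 := AlgAut.map_one G
  generalize (G : Alg σ m a ≃ₗ[F] Alg σ m a) = g at hG hG1
  replace hG : ∀ x y, g (x * y) = g x * g y := hG
  -- An automorphism preserves the left nucleus, so it maps `K` to itself.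
  have hconst : ∀ c, g (const σ m a c) = const σ m a (coeff (g (const σ m a c)) 0) := by
    intro c
    refine eq_const_of_mul_assoc hm ha fun y z => ?_
    obtain ⟨y, rfl⟩ := g.surjective y
    obtain ⟨z, rfl⟩ := g.surjective z
    rw [← hG, ← hG, ← hG, ← hG, const_mul_assoc]
  have cmul : ∀ c d, const σ m a (c * d) = const σ m a c * const σ m a d := fun c d =>
    Alg.ext fun n _ => by rw [coeff_const_mul, coeff_const, coeff_const, mul_ite, mul_zero]
  have cadd : ∀ c d, const σ m a (c + d) = const σ m a c + const σ m a d := fun c d =>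
    Alg.ext fun n _ => by
      rw [Alg.coeff_add, coeff_const, coeff_const, coeff_const]; split_ifs <;> simp
  have csmul : ∀ (b : F) c, const σ m a (b • c) = b • const σ m a c := fun b c =>
    Alg.ext fun n _ => by
      rw [Alg.coeff_smul, coeff_const, coeff_const]; split_ifs <;> simp
  let T : K →ₐ[F] K := AlgHom.ofLinearMap
    { toFun := fun c => coeff (g (const σ m a c)) 0
      map_add' := fun c d => by rw [cadd, _root_.map_add, Alg.coeff_add]
      map_smul' := fun b c => by rw [csmul, map_smul, Alg.coeff_smul]; rfl }
    (by
      change coeff (g 1) 0 = 1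
      rw [hG1]
      exact (coeff_const (σ := σ) (m := m) (a := a) 1 0).trans (if_pos rfl))
    (fun c d => by
      change coeff (g _) 0 = coeff (g _) 0 * coeff (g _) 0
      rw [cmul, hG, hconst c, coeff_const_mul, coeff_const, if_pos rfl])
  let τ : K ≃ₐ[F] K := AlgEquiv.ofBijective T (Algebra.IsAlgebraic.algHom_bijective T)
  have hτ : ∀ c, g (const σ m a c) = const σ m a (τ c) := hconst
  set t := monom σ m a 1 1 with ht
  set k := coeff (g t) 1 with hk
  -- Applying `g` to `t c = σ(c) t` shows that a nonzero coefficient of `t^n` in `g t` forces `σ^n =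
  -- σ`; since `n` and `1` are below the order of `σ`, this means `n = 1`.
  have hgt : g t = monom σ m a 1 k := by
    refine Alg.ext fun n hn => ?_
    rw [coeff_monom hm]
    by_cases h1 : 1 = n
    · rw [if_pos h1, hk, h1]
    rw [if_neg h1]
    by_contra hne
    apply h1
    have hpow : σ ^ n = σ ^ 1 := by
      refine AlgEquiv.ext fun c => ?_
      obtain ⟨c, rfl⟩ := τ.surjective c
      have e : t * const σ m a c = const σ m a (σ c) * t := by
        rw [ht, const_eq_monom, const_eq_monom, monom_mul_monom hm (NeZero.pos m),
          monom_mul_monom (NeZero.pos m) hm]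
        simp
      have e' := congrArg (fun x => coeff (g x) n) e
      simp only [hG, hτ, coeff_mul_const, coeff_const_mul] at e'
      rw [mul_comm] at e'
      rw [pow_one, mul_right_cancel₀ hne e']
      exact DFunLike.congr_fun (hcomm τ).eq c
    exact (pow_injOn_Iio_orderOf (by simpa [hσ] using hn) (by simpa [hσ] using hm) hpow).symm
  have hk0 : k ≠ 0 := by
    intro h0
    have : g t = 0 := by
      rw [hgt, h0]
      exact Alg.ext fun n _ => by rw [coeff_monom hm, ite_self, Alg.coeff_zero]
    have h := congrArg (fun x => Alg.coeff x 1) (g.map_eq_zero_iff.mp this)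
    simp [ht, coeff_monom hm, Alg.coeff_zero] at h
  have hpow : ∀ i < m, g (monom σ m a i 1) = monom σ m a i (twistProd σ k i) := by
    intro i
    induction i with
    | zero => intro _; rw [twistProd_zero, ← const_eq_monom]; exact hG1
    | succ i ih =>
      intro hi
      have e : monom σ m a (i + 1) 1 = t * monom σ m a i 1 := by
        rw [ht, monom_mul_monom hm (by omega), _root_.map_one, mul_one, add_comm]
      rw [e, hG, ih (by omega), hgt, monom_mul_monom hm (by omega), add_comm i, twistProd_add,
        twistProd_one]
  refine ⟨τ, Units.mk0 k hk0, ?_, LinearEquiv.ext fun x => Alg.ext fun n _ => ?_⟩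
  -- The condition on `τ a` comes from applying `g` to the relation `t t^(m-1) = a`.
  · have e : t * monom σ m a (m - 1) 1 = const σ m a a := by
      rw [ht, monom_mul_monom hm (by omega), show 1 + (m - 1) = 0 + m by omega,
        monom_add_degree, const_eq_monom]
      simp
    have e' := congrArg (fun x => coeff (g x) 0) e
    simp only [hG, hτ, hgt] at e'
    rw [hpow _ (by omega), monom_mul_monom hm (by omega)] at e'
    have e2 : k * (σ ^ 1) (twistProd σ k (m - 1)) = twistProd σ k m := by
      rw [show m = 1 + (m - 1) by omega, twistProd_add, twistProd_one]
      simp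
    rw [e2, show 1 + (m - 1) = 0 + m by omega, monom_add_degree, coeff_monom (NeZero.pos m),
      coeff_const] at e'
    simpa using e'.symm
  · rw [coeff_twistEquiv, Units.val_mk0]
    induction x using Alg.induction with
    | h0 => simp [Alg.coeff_zero]
    | ha x y hx hy => rw [_root_.map_add, Alg.coeff_add, hx, hy, Alg.coeff_add, _root_.map_add,
        add_mul]
    | hm i hi c =>
      have e : monom σ m a i c = const σ m a c * monom σ m a i 1 := by
        rw [const_eq_monom, monom_mul_monom (NeZero.pos m) hi]
        simp
      rw [e, hG, hτ, hpow i hi, coeff_const_mul, coeff_const_mul, coeff_monom hi, coeff_monom hi]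
      by_cases h : i = n <;> simp [h]

end NonassocCyclic

/-! ### Recognising semidirect products and dicyclic groups -/

/-- An element of order `n` gives an embedding of `ℤ/n`. -/
theorem exists_hom_zmod {G : Type*} [Group G] {n : ℕ} {g : G} (h : orderOf g ∣ n) :
    ∃ f : Multiplicative (ZMod n) →* G, (∀ k : ℤ, f (.ofAdd (k : ZMod n)) = g ^ k) ∧
      (orderOf g = n → Function.Injective f) := by
  have h0 : (zmultiplesHom (Additive G) (.ofMul g)) (n : ℤ) = 0 := by
    rw [zmultiplesHom_apply, natCast_zsmul, ← ofMul_pow, orderOf_dvd_iff_pow_eq_one.mp h,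
      ofMul_one]
  have hf : ∀ k : ℤ, AddMonoidHom.toMultiplicativeLeft (ZMod.lift n ⟨_, h0⟩)
      (.ofAdd (k : ZMod n)) = g ^ k := by
    intro k
    simp
  refine ⟨_, hf, fun hn => (injective_iff_map_eq_one _).mpr fun x hx => ?_⟩
  obtain ⟨k, hk⟩ := ZMod.intCast_surjective x.toAdd
  obtain rfl : x = .ofAdd (k : ZMod n) := hk.symm
  rw [hf, ← orderOf_dvd_iff_zpow_eq_one, hn] at hx
  rw [(ZMod.intCast_zmod_eq_zero_iff_dvd k n).mpr hx, ofAdd_zero]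

/-- A group of order at most `n r` containing `x` of order `n` and `y` of order `r` prime to `n`
with `y x y⁻¹ = x ^ q` is a semidirect product of cyclic groups. -/
theorem exists_mulEquiv_semidirectProduct {G : Type*} [Group G] [Finite G] {n r q : ℕ} {x y : G}
    (hx : orderOf x = n) (hy : orderOf y = r) (hnr : n.Coprime r) (hxy : y * x * y⁻¹ = x ^ q)
    (hcard : Nat.card G ≤ n * r) :
    ∃ φ : Multiplicative (ZMod r) →* MulAut (Multiplicative (ZMod n)),
      (∀ z, φ (.ofAdd 1) z = z ^ q) ∧
      Nonempty (G ≃* Multiplicative (ZMod n) ⋊[φ] Multiplicative (ZMod r)) := by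
  obtain ⟨f, hf, hfi⟩ := exists_hom_zmod (n := n) (g := x) hx.dvd
  obtain ⟨f', hf', hfi'⟩ := exists_hom_zmod (n := r) (g := y) hy.dvd
  replace hfi := hfi hx
  replace hfi' := hfi' hy
  have hn : 0 < n := hx ▸ orderOf_pos x
  have hr : 0 < r := hy ▸ orderOf_pos y
  have : NeZero n := ⟨hn.ne'⟩
  have : NeZero r := ⟨hr.ne'⟩
  have hconj : ∀ z, y * f z * y⁻¹ = f (z ^ q) := by
    intro z
    obtain ⟨k, hk⟩ := ZMod.intCast_surjective z.toAdd
    obtain rfl : z = .ofAdd (k : ZMod n) := hk.symm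
    rw [map_pow, hf, ← conj_zpow, hxy, ← zpow_natCast, ← zpow_natCast, zpow_comm]
  -- Under `f` the `q`-th power map becomes conjugation by `y`, so it is injective with no separate
  -- assumption on `q`.
  have hinj : Function.Injective (powMonoidHom q : Multiplicative (ZMod n) →* _) := by
    intro z z' h
    have h' := congrArg f (show z ^ q = z' ^ q from h)
    rw [← hconj, ← hconj] at h'
    exact hfi (mul_left_cancel (mul_right_cancel h'))
  let u : MulAut (Multiplicative (ZMod n)) :=
    MulEquiv.ofBijective (powMonoidHom q) (Finite.injective_iff_bijective.mp hinj)
  have hconj' : ∀ (k : ℕ) z, y ^ k * f z * (y ^ k)⁻¹ = f ((u ^ k) z) := by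
    intro k
    induction k with
    | zero => simp
    | succ k ih =>
      intro z
      have e : f ((u ^ k) (u z)) = y ^ k * (y * f z * y⁻¹) * (y ^ k)⁻¹ := by
        rw [hconj, ih]; rfl
      rw [pow_succ u, MulAut.mul_apply, e, pow_succ]
      group
  have hu : u ^ r = 1 := by
    refine MulEquiv.ext fun z => hfi ?_
    rw [← hconj', orderOf_dvd_iff_pow_eq_one.mp hy.dvd]
    simp
  obtain ⟨φ, hφ, -⟩ := exists_hom_zmod (n := r) (g := u) (orderOf_dvd_of_pow_eq_one hu)
  have hcompat : ∀ g, f.comp (φ g).toMonoidHom =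
      (MulAut.conj (f' g)).toMonoidHom.comp f := by
    intro g
    have hg : g = .ofAdd (((ZMod.val g.toAdd : ℕ) : ℤ) : ZMod r) := by simp
    refine MonoidHom.ext fun z => ?_
    rw [hg]
    simp only [MonoidHom.comp_apply, MulEquiv.coe_toMonoidHom, MulAut.conj_apply, hφ, hf',
      zpow_natCast]
    exact (hconj' _ z).symm
  refine ⟨φ, fun z => ?_, ⟨(MulEquiv.ofBijective (SemidirectProduct.lift f f' hcompat) ?_).symm⟩⟩
  · have := hφ 1
    rw [Int.cast_one, zpow_one] at this
    rw [this]
    rfl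
  · have hc : Nat.card (Multiplicative (ZMod n) ⋊[φ] Multiplicative (ZMod r)) = n * r := by
      rw [Nat.card_congr SemidirectProduct.equivProd, Nat.card_prod]
      simp
    have : Finite (Multiplicative (ZMod n) ⋊[φ] Multiplicative (ZMod r)) :=
      Finite.of_equiv _ SemidirectProduct.equivProd.symm
    refine Function.Injective.bijective_of_nat_card_le ((injective_iff_map_eq_one _).mpr ?_)
      (hcard.trans hc.ge)
    rintro ⟨z, w⟩ h
    replace h : f z * f' w = 1 := h
    have hz : f z ^ n = 1 := by
      rw [← map_pow]
      have : z ^ n = 1 := by simpa using pow_card_eq_one' (x := z)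
      rw [this, map_one]
    have hw : f' w ^ r = 1 := by
      rw [← map_pow]
      have : w ^ r = 1 := by simpa using pow_card_eq_one' (x := w)
      rw [this, map_one]
    have e : f z = (f' w)⁻¹ := eq_inv_of_mul_eq_one_left h
    -- Being inverse to `f' w`, the element `f z` has order dividing both `n` and `r`.
    have h1 : f z = 1 := by
      rw [← orderOf_eq_one_iff, ← Nat.dvd_one, ← hnr.gcd_eq_one]
      refine Nat.dvd_gcd (orderOf_dvd_of_pow_eq_one hz) (orderOf_dvd_of_pow_eq_one ?_)
      rw [e, inv_pow, hw, inv_one]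
    have hz1 : z = 1 := hfi (h1.trans (map_one f).symm)
    have hw1 : w = 1 := hfi' (by rw [map_one]; rwa [h1, one_mul] at h)
    rw [hz1, hw1]
    rfl

/-- A group of order at most `4 n` containing `y` of order `2 n` and `x` outside the powers of `y`
with `x ^ 2 = y ^ n` and `x⁻¹ y x = y⁻¹` is dicyclic. -/
theorem nonempty_mulEquiv_quaternionGroup {G : Type*} [Group G] [Finite G] {n : ℕ} {x y : G}
    (hy : orderOf y = 2 * n) (hx : x * x = y ^ n) (hxy : x⁻¹ * y * x = y⁻¹)
    (hxy' : x ∉ Subgroup.zpowers y) (hcard : Nat.card G ≤ 4 * n) :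
    Nonempty (G ≃* QuaternionGroup n) := by
  obtain ⟨f, hf, hfi⟩ := exists_hom_zmod (n := 2 * n) (g := y) hy.dvd
  replace hfi := hfi hy
  have : NeZero n := ⟨by have := orderOf_pos y; omega⟩
  let g : ZMod (2 * n) → G := fun i => f (.ofAdd i)
  have gadd : ∀ i j, g (i + j) = g i * g j := fun i j => by
    simp only [g, ofAdd_add, map_mul]
  have gneg : ∀ i, g (-i) = (g i)⁻¹ := fun i => by
    simp only [g, ofAdd_neg, map_inv]
  have gn : g n = x * x := by
    have := hf n
    rw [Int.cast_natCast, zpow_natCast] at this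
    rw [hx]
    exact this
  have hgx : ∀ i, g i * x = x * (g i)⁻¹ := by
    intro i
    obtain ⟨k, rfl⟩ := ZMod.intCast_surjective i
    have hk : g k = y ^ k := hf k
    have : x⁻¹ * y ^ k * x = (y ^ k)⁻¹ := by
      have := conj_zpow (i := k) (a := x⁻¹) (b := y)
      rw [inv_inv] at this
      rw [← this, hxy, inv_zpow]
    rw [hk, ← this]
    group
  let F : QuaternionGroup n → G
    | .a i => g i
    | .xa i => x * g i
  have hF : ∀ p r, F (p * r) = F p * F r := by
    rintro (i | i) (j | j)
    · exact gadd i j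
    · change x * g (j - i) = g i * (x * g j)
      rw [← mul_assoc, hgx, mul_assoc, sub_eq_neg_add, gadd, gneg]
    · change x * g (i + j) = x * g i * g j
      rw [gadd, mul_assoc]
    · change g (n + j - i) = x * g i * (x * g j)
      rw [mul_assoc x, ← mul_assoc (g i), hgx, add_sub_assoc, sub_eq_neg_add, gadd, gadd, gneg, gn]
      simp only [mul_assoc]
  let Φ : QuaternionGroup n →* G :=
    MonoidHom.mk' F hF
  have hc : Nat.card (QuaternionGroup n) = 4 * n := by
    rw [Nat.card_eq_fintype_card, QuaternionGroup.card]
  refine ⟨(MulEquiv.ofBijective Φ (Function.Injective.bijective_of_nat_card_le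
    ((injective_iff_map_eq_one _).mpr ?_) (hcard.trans hc.ge))).symm⟩
  rintro (i | i) h
  · have : Multiplicative.ofAdd i = 1 := hfi ((show f _ = 1 from h).trans (map_one f).symm)
    rw [show i = 0 from this]
    rfl
  · exfalso
    obtain ⟨k, rfl⟩ := ZMod.intCast_surjective i
    apply hxy'
    have hxk : x * y ^ k = 1 := by
      rw [← hf k]; exact h
    rw [eq_inv_of_mul_eq_one_left hxk]
    exact inv_mem (Subgroup.zpow_mem_zpowers y k)

/-! ### Divisibility of `(q ^ m - 1) / (q - 1)` by `m` -/

/-- If `m > 2` is a prime divisor of `q - 1`, then `m` divides `(q ^ m - 1) / (q - 1)` exactly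
once. -/
theorem exists_pow_sub_one_div_eq {q m : ℕ} (hm : m.Prime) (hq : 2 ≤ q) (hmq : m ∣ q - 1) :
    ∃ n, (q ^ m - 1) / (q - 1) = m * n ∧ (2 < m → n.Coprime m) := by
  have := Fact.mk hm
  have hs : q ^ m - 1 = (q ^ m - 1) / (q - 1) * (q - 1) :=
    (Nat.div_mul_cancel (by simpa using Nat.sub_dvd_pow_sub_pow q 1 m)).symm
  have hdvd : m ∣ (q ^ m - 1) / (q - 1) := by
    rw [← Nat.geomSum_eq hq, ← ZMod.natCast_eq_zero_iff]
    obtain ⟨c, hc⟩ := hmq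
    have : ((q : ℕ) : ZMod m) = 1 := by
      rw [show q = m * c + 1 by omega]
      simp
    simp [this]
  obtain ⟨n, hn⟩ := hdvd
  refine ⟨n, hn, fun h2 => ?_⟩
  have hqm : ¬ m ∣ q := fun h => by
    have := Nat.dvd_sub h hmq
    rw [show q - (q - 1) = 1 by omega, Nat.dvd_one] at this
    exact hm.one_lt.ne' this
  -- Lifting the exponent, with `m` odd: the valuation of `q^m - 1` exceeds that of `q - 1` by
  -- exactly one.
  have hv := padicValNat.pow_sub_pow (p := m) (x := q) (y := 1) (hm.odd_of_ne_two h2.ne')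
    (by omega) hmq hqm hm.ne_zero
  have hpos : 0 < q ^ m - 1 := Nat.sub_pos_of_lt (Nat.one_lt_pow hm.ne_zero hq)
  rw [hn] at hs
  have hn0 : n ≠ 0 := by
    rintro rfl
    rw [mul_zero, zero_mul] at hs
    omega
  rw [one_pow, hs, padicValNat.mul (mul_ne_zero hm.ne_zero hn0) (by omega),
    padicValNat.mul hm.ne_zero hn0, padicValNat_self] at hv
  rw [Nat.coprime_comm, hm.coprime_iff_not_dvd]
  intro hd
  have := one_le_padicValNat_of_dvd hn0 hd
  omega

/-! ### The group of pairs, Kummer theory and norms over finite fields -/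

namespace NonassocCyclic

variable {F K : Type*} [Field F] [Field K] [Algebra F K]

open TwistedPoly Alg

/-- The action of the Galois group on the units of `K`. -/
def unitsAction (F K : Type*) [Field F] [Field K] [Algebra F K] : (K ≃ₐ[F] K) →* MulAut Kˣ where
  toFun τ := Units.mapEquiv (τ : K ≃* K)
  map_one' := by ext; rfl
  map_mul' _ _ := by ext; rfl

theorem coe_unitsAction (τ : K ≃ₐ[F] K) (k : Kˣ) : (unitsAction F K τ k : K) = τ k := rfl

/-- The group of pairs `(k, τ)` such that `τ(a) = N(k) a`. -/
noncomputable def pairGroup (F : Type*) {K : Type*} [Field F] [Field K] [Algebra F K] (a : K) :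
    Subgroup (Kˣ ⋊[unitsAction F K] (K ≃ₐ[F] K)) where
  carrier := {p | p.right a = algebraMap F K (Algebra.norm F (p.left : K)) * a}
  one_mem' := by simp
  mul_mem' {p r} hp hr := by
    simp only [Set.mem_ofPred_eq] at hp hr ⊢
    rw [SemidirectProduct.mul_right, SemidirectProduct.mul_left, AlgEquiv.mul_apply, hr, map_mul,
      hp, AlgEquiv.commutes, Units.val_mul, coe_unitsAction, map_mul, Algebra.norm_eq_of_algEquiv,
      map_mul]
    ring
  inv_mem' {p} hp := by
    simp only [Set.mem_ofPred_eq] at hp ⊢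
    have hne : algebraMap F K (Algebra.norm F (p.left : K)) ≠ 0 := by
      rw [Ne, map_eq_zero]
      exact ((Units.map (Algebra.norm F (S := K))) p.left).ne_zero
    apply p.right.injective
    rw [SemidirectProduct.inv_right, SemidirectProduct.inv_left, coe_unitsAction,
      Algebra.norm_eq_of_algEquiv, map_mul, hp, AlgEquiv.commutes, ← mul_assoc, ← map_mul,
      ← map_mul, ← Units.val_mul, inv_mul_cancel, Units.val_one, map_one, map_one, one_mul]
    exact p.right.apply_symm_apply a

theorem mem_pairGroup {a : K} {p : Kˣ ⋊[unitsAction F K] (K ≃ₐ[F] K)} :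
    p ∈ pairGroup F a ↔ p.right a = algebraMap F K (Algebra.norm F (p.left : K)) * a := Iff.rfl

/-- The powers of the generator `σ` below its order run once through the Galois group. -/
theorem twistProd_orderOf [FiniteDimensional F K] [IsGalois F K] {σ : K ≃ₐ[F] K}
    (hσ : ∀ τ, τ ∈ Subgroup.zpowers σ) (k : K) :
    twistProd σ k (orderOf σ) = algebraMap F K (Algebra.norm F k) := by
  classical
  rw [Algebra.norm_eq_prod_automorphisms, ← IsCyclic.image_range_orderOf hσ, Finset.prod_image]
  · rfl
  · intro i hi j hj h
    exact pow_injOn_Iio_orderOf (by simpa using hi) (by simpa using hj) h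

/-- The product telescopes. This is why the pairs `(σ(b)/b, 1)` act as conjugations. -/
theorem twistProd_div (σ : K ≃ₐ[F] K) {b : K} (hb : b ≠ 0) (n : ℕ) :
    twistProd σ (σ b / b) n = (σ ^ n) b / b := by
  induction n with
  | zero => simp [twistProd_zero, hb]
  | succ n ih =>
    have : (σ ^ n) b ≠ 0 := (map_ne_zero (σ ^ n)).mpr hb
    rw [twistProd_add, ih, twistProd_one, map_div₀, pow_succ, AlgEquiv.mul_apply]
    field_simp

/-- The automorphisms of the nonassociative cyclic algebra are the maps
`∑ xₙ tⁿ ↦ ∑ τ(xₙ) (k t)ⁿ` with `τ(a) = N(k) a`. -/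
theorem exists_mulEquiv_algAut [FiniteDimensional F K] [IsGalois F K] {σ : K ≃ₐ[F] K}
    (hσ : ∀ τ, τ ∈ Subgroup.zpowers σ) {m : ℕ} [NeZero m] (hm : 1 < m) (hσm : orderOf σ = m)
    {a : K} (ha : a ∉ Set.range (algebraMap F K)) :
    ∃ e : pairGroup F a ≃* AlgAut F (Alg σ m a), ∀ p,
      (e p : Alg σ m a ≃ₗ[F] Alg σ m a) = twistEquiv σ m a p.1.right p.1.left := by
  have hcomm : ∀ τ, Commute τ σ := fun τ => by
    obtain ⟨i, rfl⟩ := hσ τ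
    exact Commute.zpow_self σ i
  have hσa : σ a ≠ a := fun h => ha <| (IsGalois.mem_range_algebraMap_iff_fixed a).mpr fun τ => by
    have : Subgroup.zpowers σ ≤ MulAction.stabilizer (K ≃ₐ[F] K) a := by
      rw [Subgroup.zpowers_le]
      exact h
    exact this (hσ τ)
  have hnorm : ∀ k : K, twistProd σ k m = algebraMap F K (Algebra.norm F k) := fun k => by
    rw [← hσm, twistProd_orderOf hσ]
  let f : pairGroup F a →* AlgAut F (Alg σ m a) := MonoidHom.mk'
    (fun p => ⟨twistEquiv σ m a p.1.right p.1.left, twistEquiv_mem (hcomm _)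
      ((mem_pairGroup.mp p.2).trans (by rw [hnorm]))⟩)
    (fun p r => Subtype.ext <| LinearEquiv.ext fun x => Alg.ext fun n _ => by
      change (p.1.right * r.1.right) (Alg.coeff x n) *
          twistProd σ (p.1.left * p.1.right r.1.left : K) n =
        p.1.right (r.1.right (Alg.coeff x n) * twistProd σ (r.1.left : K) n) *
          twistProd σ (p.1.left : K) n
      rw [AlgEquiv.mul_apply, map_mul, twistProd_mul, map_twistProd (hcomm _)]
      ring)
  have hf : Function.Bijective f := by
    refine ⟨fun p r h => Subtype.ext ?_, fun G => ?_⟩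
    · have h' : ∀ x n, p.1.right (Alg.coeff x n) * twistProd σ p.1.left n =
          r.1.right (Alg.coeff x n) * twistProd σ r.1.left n := fun x n =>
        congrArg (fun G : AlgAut F (Alg σ m a) =>
          Alg.coeff ((G : Alg σ m a ≃ₗ[F] Alg σ m a) x) n) h
      -- The unit `k` is read off from the image of `t`, and `τ` from the images of the constants.
      refine SemidirectProduct.ext (Units.ext ?_) (AlgEquiv.ext fun c => ?_)
      · have := h' (monom σ m a 1 1) 1
        rw [coeff_monom hm, if_pos rfl, map_one, map_one, one_mul, one_mul, twistProd_one,
          twistProd_one] at this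
        exact this
      · have := h' (const σ m a c) 0
        rw [coeff_const, if_pos rfl, twistProd_zero, twistProd_zero, mul_one, mul_one] at this
        exact this
    · obtain ⟨τ, k, h, e⟩ := AlgAut.exists_eq_twistEquiv hm hσm hcomm hσa G
      exact ⟨⟨⟨k, τ⟩, by rw [mem_pairGroup, h, hnorm]⟩, Subtype.ext e.symm⟩
  exact ⟨MulEquiv.ofBijective f hf, fun p => rfl⟩

/-- The Galois group has prime order, so any `τ ≠ 1` generates it and has fixed field `F`. -/
theorem mem_range_algebraMap_of_fixed [FiniteDimensional F K] [IsGalois F K]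
    (hm : (Module.finrank F K).Prime) {τ : K ≃ₐ[F] K} (hτ : τ ≠ 1) {x : K} (hx : τ x = x) :
    x ∈ Set.range (algebraMap F K) := by
  have := Fact.mk hm
  have htop := zpowers_eq_top_of_prime_card (IsGalois.card_aut_eq_finrank F K) hτ
  have hle : Subgroup.zpowers τ ≤ MulAction.stabilizer (K ≃ₐ[F] K) x := by
    rw [Subgroup.zpowers_le]
    exact hx
  refine (IsGalois.mem_range_algebraMap_iff_fixed x).mpr fun ρ => hle ?_
  rw [htop]
  trivial

/-- An eigenvalue in `F` of an element of the Galois group is a root of unity. -/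
theorem pow_finrank_eq_one_of_apply_eq [FiniteDimensional F K] [IsGalois F K] {τ : K ≃ₐ[F] K}
    {a : K} {c : F} (ha : a ≠ 0) (h : τ a = algebraMap F K c * a) :
    algebraMap F K c ^ Module.finrank F K = 1 := by
  have hpow : ∀ n : ℕ, (τ ^ n) a = algebraMap F K c ^ n * a := by
    intro n
    induction n with
    | zero => simp
    | succ n ih =>
      rw [pow_succ', AlgEquiv.mul_apply, ih, map_mul, map_pow, AlgEquiv.commutes, h]
      ring
  have h1 := hpow (Module.finrank F K)
  rw [← IsGalois.card_aut_eq_finrank, pow_card_eq_one', AlgEquiv.one_apply] at h1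
  rw [← IsGalois.card_aut_eq_finrank]
  exact mul_right_cancel₀ ha (h1.symm.trans (one_mul a).symm)

/-- If a nontrivial element of the Galois group multiplies `a` by an element of `F`, then
`a` is a multiple of a power of a Kummer generator. -/
theorem exists_eq_mul_pow_of_apply_eq [FiniteDimensional F K] [IsGalois F K]
    (hm : (Module.finrank F K).Prime) {d : K} {e : F} (hd : F⟮d⟯ = ⊤)
    (hde : d ^ Module.finrank F K = algebraMap F K e) {τ : K ≃ₐ[F] K} (hτ : τ ≠ 1) {a : K} {c : F}
    (ha : a ≠ 0) (h : τ a = algebraMap F K c * a) :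
    ∃ (l : F) (i : ℕ), l ≠ 0 ∧ i < Module.finrank F K ∧ a = algebraMap F K l * d ^ i := by
  have hdF : d ∉ Set.range (algebraMap F K) := by
    rintro ⟨x, rfl⟩
    have hbot : F⟮algebraMap F K x⟯ = ⊥ :=
      IntermediateField.adjoin_simple_eq_bot_iff.mpr (algebraMap_mem _ x)
    rw [hbot] at hd
    have := IntermediateField.finrank_top' (F := F) (E := K)
    rw [← hd, IntermediateField.finrank_bot] at this
    exact hm.one_lt.ne this
  have hd0 : d ≠ 0 := fun h => hdF ⟨0, by rw [h, map_zero]⟩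
  -- The ratio `τ(d)/d` is a nontrivial `m`-th root of unity, hence primitive as `m` is prime. The
  -- eigenvalue of `a` is then a power of it, with the exponent `i` sought.
  have hprim : IsPrimitiveRoot (τ d / d) (Module.finrank F K) := by
    have h1 : (τ d / d) ^ Module.finrank F K = 1 := by
      rw [div_pow, ← map_pow, hde, AlgEquiv.commutes, div_self]
      rw [← hde]
      exact pow_ne_zero _ hd0
    have := Fact.mk hm
    refine IsPrimitiveRoot.iff_orderOf.mpr (orderOf_eq_prime h1 fun h2 => hdF ?_)
    exact mem_range_algebraMap_of_fixed hm hτ ((div_eq_one_iff_eq hd0).mp h2)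
  have : NeZero (Module.finrank F K) := ⟨hm.ne_zero⟩
  obtain ⟨i, hi, hic⟩ := hprim.eq_pow_of_pow_eq_one (pow_finrank_eq_one_of_apply_eq ha h)
  have hfix : τ (a / d ^ i) = a / d ^ i := by
    have : τ d ≠ 0 := (map_ne_zero τ).mpr hd0
    rw [map_div₀, h, map_pow, ← hic, div_pow]
    field_simp
  obtain ⟨l, hl⟩ := mem_range_algebraMap_of_fixed hm hτ hfix
  have hal : a = algebraMap F K l * d ^ i := by
    rw [hl, div_mul_cancel₀]
    exact pow_ne_zero _ hd0
  refine ⟨l, i, ?_, hi, hal⟩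
  rintro rfl
  exact ha (by rw [hal, map_zero, zero_mul])

theorem const_inv_mul_mul_const {σ : K ≃ₐ[F] K} {m : ℕ} [NeZero m] {a : K} (b : Kˣ)
    (k : Kˣ) (hk : (k : K) = σ b / b) (x : Alg σ m a) :
    twistEquiv σ m a 1 k x = (const σ m a (b : K)⁻¹ * x) * const σ m a (b : K) := by
  refine Alg.ext fun n _ => ?_
  rw [coeff_twistEquiv, hk, twistProd_div σ b.ne_zero, coeff_mul_const, coeff_const_mul,
    AlgEquiv.one_apply]
  ring

theorem const_inv_mul_const {σ : K ≃ₐ[F] K} {m : ℕ} [NeZero m] {a : K} (b : Kˣ) :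
    const σ m a (b : K)⁻¹ * const σ m a (b : K) = 1 := by
  refine Alg.ext fun n _ => ?_
  change _ = Alg.coeff (const σ m a 1) n
  rw [coeff_const_mul, coeff_const, coeff_const]
  split_ifs <;> simp

theorem card_units_eq [Finite F] [FiniteDimensional F K] :
    Nat.card Kˣ = Nat.card F ^ Module.finrank F K - 1 := by
  have : Finite K := Module.finite_of_finite F
  rw [Nat.card_units, Module.natCard_eq_pow_finrank (K := F)]

theorem card_units_eq_mul [Finite F] [FiniteDimensional F K] :
    Nat.card Kˣ =
      (Nat.card F ^ Module.finrank F K - 1) / (Nat.card F - 1) * (Nat.card F - 1) := by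
  rw [card_units_eq (F := F), Nat.div_mul_cancel]
  simpa using Nat.sub_dvd_pow_sub_pow (Nat.card F) 1 (Module.finrank F K)

theorem algebraMap_norm_eq_pow [Finite F] [FiniteDimensional F K] (x : K) :
    algebraMap F K (Algebra.norm F x) =
      x ^ ((Nat.card F ^ Module.finrank F K - 1) / (Nat.card F - 1)) := by
  have : Finite K := Module.finite_of_finite F
  rw [FiniteField.algebraMap_norm_eq_pow, Module.natCard_eq_pow_finrank (K := F) (V := K)]

theorem exists_orderOf_eq [Finite K] {n : ℕ} (hn : n ∣ Nat.card Kˣ) : ∃ k : Kˣ, orderOf k = n := by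
  obtain ⟨g, hg⟩ := IsCyclic.exists_ofOrder_eq_natCard (α := Kˣ)
  refine ⟨g ^ (orderOf g / n), orderOf_pow_orderOf_div (orderOf_pos g).ne' (hg ▸ hn)⟩

theorem exists_frobenius [Finite F] [FiniteDimensional F K] (hm : 1 < Module.finrank F K) :
    ∃ φ : K ≃ₐ[F] K, φ ≠ 1 ∧ ∀ x, φ x = x ^ Nat.card F := by
  have := Fintype.ofFinite F
  have : Finite K := Module.finite_of_finite F
  refine ⟨FiniteField.frobeniusAlgEquivOfAlgebraic F K, fun h => ?_, fun x => ?_⟩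
  · have := FiniteField.orderOf_frobeniusAlgEquivOfAlgebraic F K
    rw [h, orderOf_one] at this
    exact hm.ne this
  · rw [Nat.card_eq_fintype_card]
    exact congrFun (FiniteField.coe_frobeniusAlgEquivOfAlgebraic F K) x

/-- The component `k` satisfies `k^(s m) = N(k)^m = 1`. It also determines `τ`, since it determines
`τ(a)` and only the identity fixes `a`. So the pairs inject into the roots of unity of order
dividing `s m`. -/
theorem card_pairGroup_le [Finite F] [FiniteDimensional F K] (hm : (Module.finrank F K).Prime)
    {a : K} (ha : a ∉ Set.range (algebraMap F K)) :
    Nat.card (pairGroup F a) ≤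
      (Nat.card F ^ Module.finrank F K - 1) / (Nat.card F - 1) * Module.finrank F K := by
  have : Finite K := Module.finite_of_finite F
  have ha0 : a ≠ 0 := fun h => ha ⟨0, by rw [h, map_zero]⟩
  set s := (Nat.card F ^ Module.finrank F K - 1) / (Nat.card F - 1) with hs
  have hs0 : s ≠ 0 := by
    intro h0
    have := card_units_eq_mul (F := F) (K := K)
    rw [← hs, h0, zero_mul] at this
    exact Nat.card_pos.ne' this
  have : NeZero (s * Module.finrank F K) := ⟨mul_ne_zero hs0 hm.ne_zero⟩
  refine le_trans (Nat.card_le_card_of_injective (β := rootsOfUnity (s * Module.finrank F K) K)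
    (fun p => ⟨p.1.left, ?_⟩) fun p r h => ?_) (card_rootsOfUnity K _)
  · rw [mem_rootsOfUnity, Units.ext_iff, Units.val_pow_eq_pow_val, pow_mul, hs,
      ← algebraMap_norm_eq_pow]
    exact pow_finrank_eq_one_of_apply_eq ha0 p.2
  · have hl : p.1.left = r.1.left := congrArg Subtype.val h
    refine Subtype.ext (SemidirectProduct.ext hl ?_)
    have hp := mem_pairGroup.mp p.2
    rw [hl, ← mem_pairGroup.mp r.2] at hp
    by_contra hne
    refine ha (mem_range_algebraMap_of_fixed hm (τ := r.1.right⁻¹ * p.1.right) ?_ ?_)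
    · rw [Ne, inv_mul_eq_one]
      exact fun h => hne h.symm
    · rw [AlgEquiv.mul_apply, hp]
      exact r.1.right.symm_apply_apply a

/-- If `a ^ m` lies in `F`, the Frobenius automorphism multiplies `a` by a norm. -/
theorem exists_norm_mul_eq [Finite F] [FiniteDimensional F K]
    (hmq : Module.finrank F K ∣ Nat.card F - 1) {φ : K ≃ₐ[F] K} (hm : (Module.finrank F K).Prime)
    (hφ1 : φ ≠ 1) (hφ : ∀ x, φ x = x ^ Nat.card F) {a : K} {b : F} (ha : a ≠ 0)
    (hab : a ^ Module.finrank F K = algebraMap F K b) :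
    ∃ k : Kˣ, φ a = algebraMap F K (Algebra.norm F (k : K)) * a := by
  have : Finite K := Module.finite_of_finite F
  have hζ : (φ a / a) ^ Module.finrank F K = 1 := by
    rw [div_pow, ← map_pow, hab, AlgEquiv.commutes, div_self]
    rw [← hab]
    exact pow_ne_zero _ ha
  -- As `q ≡ 1` modulo `m`, the `q`-th power map fixes every `m`-th root of unity.
  have hfix : φ (φ a / a) = φ a / a := by
    obtain ⟨c, hc⟩ := hmq
    have hF : Nat.card F = Nat.card F - 1 + 1 := by have := Nat.card_pos (α := F); omega
    rw [hφ (φ a / a), hF, hc, pow_add, pow_mul, hζ, one_pow, one_mul, pow_one]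
  obtain ⟨c, hc⟩ := mem_range_algebraMap_of_fixed hm hφ1 hfix
  obtain ⟨k, hk⟩ := FiniteField.norm_surjective F K c
  have hk0 : k ≠ 0 := by
    rintro rfl
    rw [Algebra.norm_zero] at hk
    rw [← hk, map_zero, eq_comm, div_eq_zero_iff, map_eq_zero] at hc
    exact ha (or_self_iff.mp hc)
  exact ⟨Units.mk0 k hk0, by rw [Units.val_mk0, hk, hc, div_mul_cancel₀ _ ha]⟩

/-- The left component is `k φ(k) ⋯ φⁿ⁻¹(k)`, and `φ` raises to the power `q`. For `n = m` the
exponent is `s`, so the norm of `k` appears. -/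
theorem pair_pow {φ : K ≃ₐ[F] K} {q : ℕ} (hφ : ∀ x, φ x = x ^ q) (k : Kˣ) (n : ℕ) :
    (⟨k, φ⟩ : Kˣ ⋊[unitsAction F K] (K ≃ₐ[F] K)) ^ n = ⟨k ^ ∑ i ∈ Finset.range n, q ^ i, φ ^ n⟩ := by
  induction n with
  | zero => simp
  | succ n ih =>
    rw [pow_succ', ih]
    refine SemidirectProduct.ext (Units.ext ?_) (pow_succ' φ n).symm
    rw [SemidirectProduct.mul_left, Units.val_mul, coe_unitsAction, hφ, geom_sum_succ, pow_add,
      pow_one, mul_comm q, pow_mul, mul_comm]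
    simp

end NonassocCyclic

/-! ### Structure of the group of pairs in the three cases -/

namespace NonassocCyclic

variable {F K : Type*} [Field F] [Field K] [Algebra F K]

open TwistedPoly Alg

/-- If every pair has trivial Galois component, the pair group has order `(q ^ m - 1) / (q - 1)`. -/
theorem card_pairGroup_of_right_eq_one [Finite F] [FiniteDimensional F K] {a : K} (ha : a ≠ 0)
    (h : ∀ p ∈ pairGroup F a, p.right = 1) :
    Nat.card (pairGroup F a) =
      (Nat.card F ^ Module.finrank F K - 1) / (Nat.card F - 1) := by
  have : Finite K := Module.finite_of_finite F
  set s := (Nat.card F ^ Module.finrank F K - 1) / (Nat.card F - 1) with hs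
  have hcard : Nat.card Kˣ = s * (Nat.card F - 1) := card_units_eq_mul
  have : NeZero s := ⟨fun h0 => Nat.card_pos.ne' (hcard.trans (by rw [h0, zero_mul]))⟩
  obtain ⟨ω, hω⟩ := exists_orderOf_eq (K := K) (n := s) (hcard ▸ dvd_mul_right _ _)
  rw [← (IsPrimitiveRoot.iff_orderOf.mpr hω).card_rootsOfUnity']
  have hmem : ∀ k : Kˣ, SemidirectProduct.inl k ∈ pairGroup F a ↔ k ∈ rootsOfUnity s K := by
    intro k
    rw [mem_pairGroup, mem_rootsOfUnity, Units.ext_iff, Units.val_pow_eq_pow_val, hs,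
      ← algebraMap_norm_eq_pow, Units.val_one, SemidirectProduct.right_inl,
      SemidirectProduct.left_inl, AlgEquiv.one_apply]
    exact ⟨fun h => (mul_right_cancel₀ ha ((one_mul a).trans h)).symm,
      fun h => by rw [h, one_mul]⟩
  have heq : ∀ p ∈ pairGroup F a, p = SemidirectProduct.inl p.left := fun p hp =>
    SemidirectProduct.ext rfl (h p hp)
  exact Nat.card_congr
    { toFun := fun p => ⟨p.1.left, (hmem _).mp (heq p.1 p.2 ▸ p.2)⟩
      invFun := fun k => ⟨SemidirectProduct.inl k.1, (hmem _).mpr k.2⟩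
      left_inv := fun p => Subtype.ext (heq p.1 p.2).symm
      right_inv := fun k => rfl }

theorem norm_apply_div_self [FiniteDimensional F K] (σ : K ≃ₐ[F] K) {b : K} (hb : b ≠ 0) :
    Algebra.norm F (σ b / b) = 1 := by
  have hN : Algebra.norm F b ≠ 0 := Algebra.norm_ne_zero_iff.mpr hb
  refine mul_right_cancel₀ hN ?_
  rw [← map_mul, div_mul_cancel₀ _ hb, Algebra.norm_eq_of_algEquiv, one_mul]

/-- Hilbert Theorem 90 for extensions of prime degree of a finite field. -/
theorem exists_eq_apply_div_self [Finite F] [FiniteDimensional F K]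
    (hm : (Module.finrank F K).Prime) {σ : K ≃ₐ[F] K} (hσ : σ ≠ 1) {k : K}
    (hk : Algebra.norm F k = 1) : ∃ b : Kˣ, k = σ b / b := by
  have : Finite K := Module.finite_of_finite F
  set s := (Nat.card F ^ Module.finrank F K - 1) / (Nat.card F - 1) with hs
  have hcard : Nat.card Kˣ = s * (Nat.card F - 1) := card_units_eq_mul
  have : NeZero s := ⟨fun h0 => Nat.card_pos.ne' (hcard.trans (by rw [h0, zero_mul]))⟩
  have hpow : ∀ x : K, Algebra.norm F x = 1 → x ^ s = 1 := fun x hx => by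
    rw [hs, ← algebraMap_norm_eq_pow, hx, map_one]
  obtain ⟨α, hα⟩ := IsCyclic.exists_ofOrder_eq_natCard (α := Kˣ)
  -- If `(σ(α)/α)^j = 1`, then `α^j` lies in `F`, so `α^(j(q-1)) = 1` and `s(q-1)` divides `j(q-1)`.
  -- Elements of norm one are `s`-th roots of unity, hence powers of `σ(α)/α`.
  have hprim : IsPrimitiveRoot (σ α / α : K) s := by
    refine ⟨hpow _ (norm_apply_div_self σ α.ne_zero), fun j hj => ?_⟩
    rw [div_pow, ← map_pow, div_eq_one_iff_eq (pow_ne_zero _ α.ne_zero)] at hj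
    obtain ⟨x, hx⟩ := mem_range_algebraMap_of_fixed hm hσ hj
    have hx0 : x ≠ 0 := by
      rintro rfl
      rw [map_zero] at hx
      exact pow_ne_zero _ α.ne_zero hx.symm
    have hone : α ^ (j * (Nat.card F - 1)) = 1 := by
      have := Fintype.ofFinite F
      rw [Units.ext_iff, Units.val_pow_eq_pow_val, pow_mul, ← hx, ← map_pow,
        Nat.card_eq_fintype_card, FiniteField.pow_card_sub_one_eq_one x hx0, map_one,
        Units.val_one]
    have hdvd := orderOf_dvd_of_pow_eq_one hone
    rw [hα, hcard] at hdvd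
    exact Nat.dvd_of_mul_dvd_mul_right (Nat.sub_pos_of_lt Finite.one_lt_card) hdvd
  obtain ⟨i, -, hi⟩ := hprim.eq_pow_of_pow_eq_one (hpow k hk)
  exact ⟨α ^ i, by rw [← hi, Units.val_pow_eq_pow_val, map_pow, div_pow]⟩

/-- If `a ^ m` lies in `F`, for `m > 2`, the pair group is a semidirect product. -/
theorem exists_pairGroup_mulEquiv_semidirectProduct [Finite F] [FiniteDimensional F K]
    {m q : ℕ} (hK : Module.finrank F K = m) (hq : Nat.card F = q) (hm : m.Prime)
    (hmq : m ∣ q - 1) (hm2 : 2 < m) {a : K} (ha : a ∉ Set.range (algebraMap F K)) {b : F}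
    (hab : a ^ m = algebraMap F K b) :
    m ∣ (q ^ m - 1) / (q - 1) ∧
      ∃ φ : Multiplicative (ZMod (m ^ 2)) →*
          MulAut (Multiplicative (ZMod ((q ^ m - 1) / (q - 1) / m))),
        (∀ x, φ (Multiplicative.ofAdd 1) x = x ^ q) ∧
        Nonempty (pairGroup F a ≃* Multiplicative (ZMod ((q ^ m - 1) / (q - 1) / m)) ⋊[φ]
          Multiplicative (ZMod (m ^ 2))) := by
  subst hK hq
  have : Finite K := Module.finite_of_finite F
  have := Fact.mk hm
  have ha0 : a ≠ 0 := fun h => ha ⟨0, by rw [h, map_zero]⟩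
  have hq2 : 2 ≤ Nat.card F := Finite.one_lt_card
  obtain ⟨n, hn, hcop⟩ := exists_pow_sub_one_div_eq hm hq2 hmq
  rw [hn]
  refine ⟨dvd_mul_right _ _, ?_⟩
  rw [Nat.mul_div_cancel_left _ hm.pos]
  obtain ⟨φ, hφ1, hφ⟩ := exists_frobenius (F := F) (K := K) hm.one_lt
  obtain ⟨k, hk⟩ := exists_norm_mul_eq hmq hm hφ1 hφ ha0 hab
  obtain ⟨ω, hω⟩ := exists_orderOf_eq (K := K) (n := n)
    (by rw [card_units_eq_mul (F := F), hn, mul_assoc, mul_left_comm]; exact dvd_mul_right _ _)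
  have hωmem : SemidirectProduct.inl ω ∈ pairGroup F a := by
    rw [mem_pairGroup, SemidirectProduct.right_inl, SemidirectProduct.left_inl,
      algebraMap_norm_eq_pow, hn, mul_comm _ n, pow_mul, ← Units.val_pow_eq_pow_val,
      orderOf_dvd_iff_pow_eq_one.mp hω.dvd]
    simp
  let x : pairGroup F a := ⟨SemidirectProduct.inl ω, hωmem⟩
  let y : pairGroup F a := ⟨⟨k, φ⟩, hk⟩
  have hx : orderOf x = n := by
    rw [← Subgroup.orderOf_coe, orderOf_injective _ SemidirectProduct.inl_injective, hω]
  have hym : ((y ^ Module.finrank F K : pairGroup F a) : Kˣ ⋊[unitsAction F K] (K ≃ₐ[F] K)) =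
      SemidirectProduct.inl
        (k ^ ((Nat.card F ^ Module.finrank F K - 1) / (Nat.card F - 1))) := by
    rw [SubmonoidClass.coe_pow, pair_pow hφ, Nat.geomSum_eq hq2]
    refine SemidirectProduct.ext rfl ?_
    rw [SemidirectProduct.right_inl, ← IsGalois.card_aut_eq_finrank, pow_card_eq_one']
  -- Here `y^m = (N(k), 1)`. It is nontrivial because `N(k) = 1` would make `φ` fix `a`, and its
  -- `m`-th power is trivial because `N(k)` is an eigenvalue of `φ`.
  have hy : orderOf y = Module.finrank F K ^ 2 := by
    refine orderOf_eq_prime_pow (fun h => ?_) ?_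
    · rw [pow_one] at h
      rw [h] at hym
      have h1 : (1 : Kˣ) = _ := congrArg SemidirectProduct.left hym
      rw [SemidirectProduct.left_inl, Units.ext_iff, Units.val_pow_eq_pow_val,
        ← algebraMap_norm_eq_pow] at h1
      rw [← h1, Units.val_one, one_mul] at hk
      exact ha (mem_range_algebraMap_of_fixed hm hφ1 hk)
    · refine Subtype.ext ?_
      rw [pow_two, pow_mul, SubmonoidClass.coe_pow, hym, ← map_pow]
      have : (k ^ ((Nat.card F ^ Module.finrank F K - 1) / (Nat.card F - 1))) ^
          Module.finrank F K = 1 := by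
        rw [Units.ext_iff, Units.val_pow_eq_pow_val, Units.val_pow_eq_pow_val,
          ← algebraMap_norm_eq_pow]
        exact pow_finrank_eq_one_of_apply_eq ha0 hk
      rw [this, map_one]
      rfl
  -- Conjugation by `y` acts on `ω` through `φ`, which is the `q`-th power map.
  have hxy : y * x * y⁻¹ = x ^ Nat.card F := by
    rw [mul_inv_eq_iff_eq_mul]
    refine Subtype.ext (SemidirectProduct.ext (Units.ext ?_) ?_)
    · change (k : K) * φ ω = ((SemidirectProduct.inl ω ^ Nat.card F *
        (⟨k, φ⟩ : Kˣ ⋊[unitsAction F K] (K ≃ₐ[F] K))).left : K)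
      rw [hφ, ← map_pow, SemidirectProduct.mul_left, SemidirectProduct.left_inl,
        SemidirectProduct.right_inl, map_one, MulAut.one_apply, Units.val_mul,
        Units.val_pow_eq_pow_val, mul_comm]
    · change φ * 1 = (SemidirectProduct.inl ω ^ Nat.card F *
        (⟨k, φ⟩ : Kˣ ⋊[unitsAction F K] (K ≃ₐ[F] K))).right
      rw [← map_pow, SemidirectProduct.mul_right, SemidirectProduct.right_inl, mul_one, one_mul]
  have : Finite (Kˣ ⋊[unitsAction F K] (K ≃ₐ[F] K)) :=
    Finite.of_equiv _ SemidirectProduct.equivProd.symm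
  refine exists_mulEquiv_semidirectProduct hx hy ((hcop hm2).pow_right 2) hxy ?_
  refine (card_pairGroup_le hm ha).trans ?_
  rw [hn, pow_two, mul_comm _ n, mul_assoc]

/-- If `a ^ 2` lies in `F`, for `m = 2`, the pair group is dicyclic. -/
theorem nonempty_pairGroup_mulEquiv_quaternionGroup [Finite F] [FiniteDimensional F K]
    {q : ℕ} (hK : Module.finrank F K = 2) (hq : Nat.card F = q) (hmq : 2 ∣ q - 1) {a : K}
    (ha : a ∉ Set.range (algebraMap F K)) {b : F} (hab : a ^ 2 = algebraMap F K b) :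
    Nonempty (pairGroup F a ≃* QuaternionGroup ((q + 1) / 2)) := by
  subst hq
  have : Finite K := Module.finite_of_finite F
  have hm : (Module.finrank F K).Prime := hK ▸ Nat.prime_two
  have ha0 : a ≠ 0 := fun h => ha ⟨0, by rw [h, map_zero]⟩
  have hq2 : 2 ≤ Nat.card F := Finite.one_lt_card
  obtain ⟨φ, hφ1, hφ⟩ := exists_frobenius (F := F) (K := K) hm.one_lt
  obtain ⟨k, hk⟩ := exists_norm_mul_eq (hK.symm ▸ hmq) hm hφ1 hφ ha0 (hK.symm ▸ hab)
  obtain ⟨n, hn⟩ : ∃ n, Nat.card F + 1 = 2 * n := ⟨(Nat.card F + 1) / 2, by omega⟩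
  have hs : (Nat.card F ^ Module.finrank F K - 1) / (Nat.card F - 1) = 2 * n := by
    rw [hK, ← Nat.geomSum_eq hq2, Finset.sum_range_succ, Finset.sum_range_one, pow_zero, pow_one]
    omega
  rw [hn, Nat.mul_div_cancel_left _ two_pos]
  obtain ⟨ω, hω⟩ := exists_orderOf_eq (K := K) (n := 2 * n)
    (by rw [card_units_eq_mul (F := F), hs]; exact dvd_mul_right _ _)
  have hω1 : ω ^ (2 * n) = 1 := orderOf_dvd_iff_pow_eq_one.mp hω.dvd
  have hωmem : SemidirectProduct.inl ω ∈ pairGroup F a := by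
    rw [mem_pairGroup, SemidirectProduct.right_inl, SemidirectProduct.left_inl,
      algebraMap_norm_eq_pow, hs, ← Units.val_pow_eq_pow_val, hω1]
    simp
  let y : pairGroup F a := ⟨SemidirectProduct.inl ω, hωmem⟩
  let x : pairGroup F a := ⟨⟨k, φ⟩, hk⟩
  have hy : orderOf y = 2 * n := by
    rw [← Subgroup.orderOf_coe, orderOf_injective _ SemidirectProduct.inl_injective, hω]
  -- Both sides have square `1` and differ from `1`, so both are `-1`; on the left the element is
  -- `N(k)`.
  have hkn : k ^ (2 * n) = ω ^ n := by
    have hk1 : ((k : K) ^ (2 * n)) ^ 2 = 1 := by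
      rw [← hs, ← algebraMap_norm_eq_pow, ← hK]
      exact pow_finrank_eq_one_of_apply_eq ha0 hk
    have hk2 : (k : K) ^ (2 * n) ≠ 1 := by
      intro h
      rw [algebraMap_norm_eq_pow, hs, h, one_mul] at hk
      exact ha (mem_range_algebraMap_of_fixed hm hφ1 hk)
    have hw1 : ((ω : K) ^ n) ^ 2 = 1 := by
      rw [← pow_mul, mul_comm, ← Units.val_pow_eq_pow_val, hω1, Units.val_one]
    have hw2 : (ω : K) ^ n ≠ 1 := by
      intro h
      have := orderOf_dvd_of_pow_eq_one (x := ω) (n := n) (Units.ext (by simpa using h))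
      rw [hω] at this
      have := Nat.le_of_dvd (by omega) this
      omega
    refine Units.ext ?_
    rw [Units.val_pow_eq_pow_val, Units.val_pow_eq_pow_val,
      (sq_eq_one_iff.mp hk1).resolve_left hk2,
      (sq_eq_one_iff.mp hw1).resolve_left hw2]
  have hx : x * x = y ^ n := by
    refine Subtype.ext ?_
    rw [← pow_two, SubmonoidClass.coe_pow, SubmonoidClass.coe_pow, pair_pow hφ, ← map_pow,
      Finset.sum_range_succ, Finset.sum_range_one, pow_zero, pow_one, add_comm, hn, hkn]
    refine SemidirectProduct.ext rfl ?_
    rw [SemidirectProduct.right_inl, ← hK, ← IsGalois.card_aut_eq_finrank, pow_card_eq_one']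
  have hxy : x⁻¹ * y * x = y⁻¹ := by
    rw [mul_assoc, inv_mul_eq_iff_eq_mul]
    refine Subtype.ext (SemidirectProduct.ext (Units.ext ?_) ?_)
    · change ((SemidirectProduct.inl ω *
        (⟨k, φ⟩ : Kˣ ⋊[unitsAction F K] (K ≃ₐ[F] K))).left : K) =
        (((⟨k, φ⟩ : Kˣ ⋊[unitsAction F K] (K ≃ₐ[F] K)) * (SemidirectProduct.inl ω)⁻¹).left : K)
      -- Since `ω^(q+1) = 1`, the Frobenius inverts `ω`.
      have hinv : ((ω⁻¹ : Kˣ) : K) ^ Nat.card F = ω := by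
        have : ω⁻¹ ^ Nat.card F = ω := by
          rw [inv_pow, inv_eq_iff_mul_eq_one, ← pow_succ, hn, hω1]
        rw [← Units.val_pow_eq_pow_val, this]
      rw [← map_inv, SemidirectProduct.mul_left, SemidirectProduct.left_inl,
        SemidirectProduct.right_inl, map_one, MulAut.one_apply, SemidirectProduct.mul_left,
        Units.val_mul, Units.val_mul, coe_unitsAction, SemidirectProduct.left_inl, hφ, hinv,
        mul_comm]
    · change (SemidirectProduct.inl ω *
        (⟨k, φ⟩ : Kˣ ⋊[unitsAction F K] (K ≃ₐ[F] K))).right =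
        ((⟨k, φ⟩ : Kˣ ⋊[unitsAction F K] (K ≃ₐ[F] K)) * (SemidirectProduct.inl ω)⁻¹).right
      rw [← map_inv, SemidirectProduct.mul_right, SemidirectProduct.mul_right,
        SemidirectProduct.right_inl, SemidirectProduct.right_inl, mul_one, one_mul]
  have hxy' : x ∉ Subgroup.zpowers y := by
    rintro ⟨i, hi⟩
    have h := congrArg (fun p : pairGroup F a => p.1.right) hi
    simp only [x, y, Subgroup.coe_zpow, ← map_zpow, SemidirectProduct.right_inl] at h
    exact hφ1 h.symm
  have : Finite (Kˣ ⋊[unitsAction F K] (K ≃ₐ[F] K)) :=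
    Finite.of_equiv _ SemidirectProduct.equivProd.symm
  refine nonempty_mulEquiv_quaternionGroup hy hx hxy hxy' ?_
  refine (card_pairGroup_le hm ha).trans ?_
  rw [hs, hK]
  omega

end NonassocCyclic

/-! ### The main theorem -/

open NonassocCyclic

theorem mainTheorem8 {F K : Type*} [Field F] [Finite F] [Field K] [Algebra F K]
    (q m s : ℕ) (hq : Nat.card F = q) [Fact m.Prime] (hK : Module.finrank F K = m)
    (hmq : m ∣ q - 1) (hs : s = (q ^ m - 1) / (q - 1))
    (σ : K ≃ₐ[F] K) (hσ : ∀ τ : K ≃ₐ[F] K, τ ∈ Subgroup.zpowers σ) :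
    (∃ (d : K) (e : F), Irreducible (Polynomial.X ^ m - Polynomial.C e) ∧
      Polynomial.aeval d (Polynomial.X ^ m - Polynomial.C e) = 0 ∧ F⟮d⟯ = ⊤) ∧
    ∀ (d : K) (e : F), F⟮d⟯ = ⊤ → d ^ m = algebraMap F K e →
      ∀ a : K, a ∉ Set.range (algebraMap F K) →
        ((∀ (l : F) (i : ℕ), l ≠ 0 → i < m → a ≠ algebraMap F K l * d ^ i) →
          (∀ α : Kˣ, Subgroup.zpowers α = ⊤ →
            ∃ G : AlgAut F (Alg σ m a),
              (∀ x : Alg σ m a, (G : Alg σ m a ≃ₗ[F] Alg σ m a) x =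
                (Alg.const σ m a (α : K)⁻¹ * x) * Alg.const σ m a (α : K)) ∧
              Subgroup.zpowers G = ⊤) ∧
          Nonempty (AlgAut F (Alg σ m a) ≃* Multiplicative (ZMod s)) ∧
          ∀ G : AlgAut F (Alg σ m a), IsInner G) ∧
        (m = 2 → ∀ l : F, l ≠ 0 → a = algebraMap F K l * d →
          Nat.card (AlgAut F (Alg σ m a)) = 2 * q + 2 ∧
          Nonempty (AlgAut F (Alg σ m a) ≃* QuaternionGroup ((q + 1) / 2))) ∧
        (2 < m → ∀ (l : F) (i : ℕ), l ≠ 0 → 1 ≤ i → i < m → a = algebraMap F K l * d ^ i →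
          m ∣ s ∧ ∃ φ : Multiplicative (ZMod (m ^ 2)) →* MulAut (Multiplicative (ZMod (s / m))),
            (∀ x, φ (Multiplicative.ofAdd 1) x = x ^ q) ∧
            Nonempty (AlgAut F (Alg σ m a) ≃*
              Multiplicative (ZMod (s / m)) ⋊[φ] Multiplicative (ZMod (m ^ 2)))) := by
  have hm : m.Prime := Fact.out
  have hF : FiniteDimensional F K := Module.finite_of_finrank_pos (hK ▸ hm.pos)
  have : Finite K := Module.finite_of_finite F
  have hσm : orderOf σ = m := by
    rw [orderOf_eq_card_of_forall_mem_zpowers hσ, IsGalois.card_aut_eq_finrank, hK]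
  have hσ1 : σ ≠ 1 := by
    rintro rfl
    exact hm.one_lt.ne (orderOf_one.symm.trans hσm)
  have hm' : (Module.finrank F K).Prime := hK.symm ▸ hm
  have hcyc : IsCyclic (K ≃ₐ[F] K) := ⟨σ, hσ⟩
  refine ⟨?_, ?_⟩
  -- As `m ∣ q - 1`, the field `F` contains a primitive `m`-th root of unity, so Kummer theory
  -- provides `d`.
  · have hroots : (primitiveRoots (Module.finrank F K) F).Nonempty := by
      obtain ⟨ζ, hζ⟩ := exists_orderOf_eq (K := F) (n := m) (by rwa [Nat.card_units, hq])
      refine ⟨ζ, (mem_primitiveRoots (hm'.pos)).mpr ?_⟩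
      rw [IsPrimitiveRoot.coe_units_iff, hK]
      exact IsPrimitiveRoot.iff_orderOf.mpr hζ
    obtain ⟨d, ⟨e, he⟩, hd⟩ := exists_root_adjoin_eq_top_of_isCyclic F K hroots
    refine ⟨d, e, ?_, ?_, hd⟩
    · rw [← hK]
      exact irreducible_X_pow_sub_C_of_root_adjoin_eq_top he.symm hd
    · rw [← hK]
      simp [he]
  intro d e hd hde a ha
  have ha0 : a ≠ 0 := fun h => ha ⟨0, by rw [h, map_zero]⟩
  obtain ⟨E, hE⟩ := exists_mulEquiv_algAut hσ hm.one_lt hσm ha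
  have hab : ∀ (l : F) (i : ℕ), a = algebraMap F K l * d ^ i →
      a ^ m = algebraMap F K (l ^ m * e ^ i) := fun l i h => by
    rw [h, mul_pow, ← pow_mul, mul_comm i, pow_mul, hde, map_mul, map_pow, map_pow]
  refine ⟨fun hne => ?_, ?_, ?_⟩
  · have hright : ∀ p ∈ pairGroup F a, p.right = 1 := by
      intro p hp
      by_contra h1
      obtain ⟨l, i, hl, hi, h⟩ := exists_eq_mul_pow_of_apply_eq hm' hd (hK.symm ▸ hde) h1 ha0 hp
      exact hne l i hl (hK ▸ hi) h
    have hcard : Nat.card (AlgAut F (Alg σ m a)) = s := by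
      rw [← Nat.card_congr E.toEquiv, card_pairGroup_of_right_eq_one ha0 hright, hs, hq, hK]
    have hdiv : ∀ p ∈ pairGroup F a, ∃ b : Kˣ, (p.left : K) = σ b / b := by
      intro p hp
      have hp1 := mem_pairGroup.mp hp
      rw [hright p hp, AlgEquiv.one_apply] at hp1
      have hN : Algebra.norm F (p.left : K) = 1 := by
        refine (algebraMap F K).injective (mul_right_cancel₀ ha0 ?_)
        rw [← hp1, map_one, one_mul]
      exact exists_eq_apply_div_self hm' hσ1 hN
    have hmem : ∀ b : Kˣ, ∃ p ∈ pairGroup F a, p.right = 1 ∧ (p.left : K) = σ b / b := by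
      intro b
      have hσb : σ b ≠ 0 := (map_ne_zero σ).mpr b.ne_zero
      refine ⟨SemidirectProduct.inl (Units.mk0 (σ b / b) (div_ne_zero hσb b.ne_zero)), ?_, rfl, rfl⟩
      rw [mem_pairGroup, SemidirectProduct.right_inl, SemidirectProduct.left_inl, Units.val_mk0,
        norm_apply_div_self σ b.ne_zero, map_one, one_mul, AlgEquiv.one_apply]
    have hgen : ∀ α : Kˣ, Subgroup.zpowers α = ⊤ →
        ∃ G : AlgAut F (Alg σ m a),
          (∀ x : Alg σ m a, (G : Alg σ m a ≃ₗ[F] Alg σ m a) x =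
            (Alg.const σ m a (α : K)⁻¹ * x) * Alg.const σ m a (α : K)) ∧
          Subgroup.zpowers G = ⊤ := by
      intro α hα
      obtain ⟨p, hp, hp1, hpα⟩ := hmem α
      refine ⟨E ⟨p, hp⟩, fun x => ?_, ?_⟩
      · rw [hE, ← const_inv_mul_mul_const α p.left hpα, ← hp1]
      · rw [← MulEquiv.coe_toMonoidHom, ← MonoidHom.map_zpowers]
        -- Any pair has `k = σ(b)/b` with `b = α^j`, so it is the `j`-th power of the pair of `α`.
        have htop : Subgroup.zpowers (⟨p, hp⟩ : pairGroup F a) = ⊤ := by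
          rw [Subgroup.eq_top_iff']
          intro r
          obtain ⟨b, hb⟩ := hdiv r.1 r.2
          obtain ⟨j, rfl⟩ : b ∈ Subgroup.zpowers α := hα ▸ Subgroup.mem_top b
          refine ⟨j, Subtype.ext ?_⟩
          have hpl : p = SemidirectProduct.inl p.left := SemidirectProduct.ext rfl hp1
          change p ^ j = r.1
          rw [hpl, ← map_zpow]
          refine SemidirectProduct.ext (Units.ext ?_) (hright r.1 r.2).symm
          rw [hb, SemidirectProduct.left_inl, Units.val_zpow_eq_zpow_val, hpα,
            Units.val_zpow_eq_zpow_val, map_zpow₀, div_zpow]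
        rw [htop, Subgroup.map_top_of_surjective _ E.surjective]
    refine ⟨hgen, ?_, fun G => ?_⟩
    · obtain ⟨α, hα⟩ := IsCyclic.exists_generator (α := Kˣ)
      obtain ⟨G, -, hG⟩ := hgen α ((Subgroup.eq_top_iff' _).mpr hα)
      exact ⟨(zmodMulEquivOfGenerator ((Subgroup.eq_top_iff' _).mp hG) hcard).symm⟩
    · obtain ⟨p, rfl⟩ := E.surjective G
      obtain ⟨b, hb⟩ := hdiv p.1 p.2
      refine ⟨Alg.const σ m a b, Alg.const σ m a (b : K)⁻¹, fun h => ?_,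
        const_inv_mul_const b, fun x => ?_⟩
      · have h0 := congrArg (fun x => Alg.coeff x 0) h
        simp only [Alg.coeff_const, if_true, Alg.coeff_zero] at h0
        exact b.ne_zero h0
      · rw [hE, ← const_inv_mul_mul_const b p.1.left hb, hright p.1 p.2]
  · rintro rfl l - hal
    have hab' := hab l 1 (by rw [pow_one, hal])
    obtain ⟨Q⟩ := nonempty_pairGroup_mulEquiv_quaternionGroup hK hq hmq ha hab'
    have hq2 : 2 ≤ q := hq ▸ Finite.one_lt_card
    have : NeZero ((q + 1) / 2) := ⟨by omega⟩
    refine ⟨?_, ⟨E.symm.trans Q⟩⟩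
    -- Since `q` is odd, the order `4 ((q+1)/2)` equals `2q + 2`.
    rw [Nat.card_congr (E.symm.trans Q).toEquiv, Nat.card_eq_fintype_card, QuaternionGroup.card]
    omega
  · intro hm2 l i _ _ _ hal
    obtain ⟨h1, φ, h2, ⟨Q⟩⟩ := exists_pairGroup_mulEquiv_semidirectProduct hK hq hm hmq hm2 ha
      (hab l i hal)
    subst hs
    exact ⟨h1, φ, h2, ⟨E.symm.trans Q⟩⟩
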